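/- Let $k$ be a field of characteristic zero and let $R=k[x_1,\dots,x_n]$ with its standard grading ($\deg x_i=1$). For a proper homogeneous ideal $I\subset R$ with $A=R/I$ artinian, the Hilbert function of $A$ is $d\mapsto\dim_k A_d$. The algebra $A$ has the Weak Lefschetz Property (WLP) if, for a generic linear form $L\in R_1$ and every $d\ge 0$, the multiplication map $\cdot L\colon A_d\to A_{d+1}$ has maximal rank. The ideal $I$, and the algebra $A$, are called Gotzmann if for every $d\ge 0$ one has $\dim_k R_1I_d=\dim_k R_1L_d$, where $L_d\subseteq R_d$ is spanned by the $\dim_k I_d$ lexicographically largest monomials of degree $d$ (by Macaulay's theorem this is the smallest possible dimension). Let $H$ be a finite Hilbert function, i.e. the Hilbert function of some artinian algebra $R/I$ as above. Then all artinian algebras $R/I$ with Hilbert function $H$ have the WLP if and only if every Gotzmann algebra $R/I$ with Hilbert function $H$ has the WLP. Moreover, this happens if and only if at least one Gotzmann algebra $R/I$ with Hilbert function $H$ has the WLP. -/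

import Mathlib

open MvPolynomial

noncomputable section

attribute [local instance] MvPolynomial.gradedAlgebra

/-- `I` defines a standard graded artinian algebra `K[x_1, …, x_n] / I`: the ideal is homogeneous
for the usual grading (all variables of degree `1`), proper, and the quotient ring is artinian. -/
def DefinesArtinianAlgebra {K : Type*} [Field K] {n : ℕ} (I : Ideal (MvPolynomial (Fin n) K)) :
    Prop :=
  I.IsHomogeneous (homogeneousSubmodule (Fin n) K) ∧ I ≠ ⊤ ∧
    IsArtinianRing (MvPolynomial (Fin n) K ⧸ I)

/-- The degree `d` component `A_d` of `A = K[x_1, …, x_n] / I`. -/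
def quotientPiece {K : Type*} [Field K] {n : ℕ} (I : Ideal (MvPolynomial (Fin n) K)) (d : ℕ) :
    Submodule K (MvPolynomial (Fin n) K ⧸ I) :=
  (homogeneousSubmodule (Fin n) K d).map (Ideal.Quotient.mkₐ K I).toLinearMap

/-- The Hilbert function `d ↦ dim_K A_d` of `A = K[x_1, …, x_n] / I`. -/
def hilbertFunction {K : Type*} [Field K] {n : ℕ} (I : Ideal (MvPolynomial (Fin n) K)) (d : ℕ) :
    ℕ :=
  Module.finrank K (quotientPiece I d)

/-- `H` is the Hilbert function of some artinian quotient of `K[x_1, …, x_n]`. -/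
def IsFiniteHilbertFunction (K : Type*) [Field K] (n : ℕ) (H : ℕ → ℕ) : Prop :=
  ∃ I : Ideal (MvPolynomial (Fin n) K), DefinesArtinianAlgebra I ∧ hilbertFunction I = H

/-- The linear form `c_1 x_1 + ⋯ + c_n x_n`. -/
def linearForm {K : Type*} [Field K] {n : ℕ} (c : Fin n → K) : MvPolynomial (Fin n) K :=
  ∑ i, C (c i) * X i

/-- For every `d`, multiplication by `L` from `A_d` to `A_{d+1}` has the largest possible rank,
where `A = K[x_1, …, x_n] / I`. -/
def HasMaximalRank {K : Type*} [Field K] {n : ℕ} (I : Ideal (MvPolynomial (Fin n) K))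
    (L : MvPolynomial (Fin n) K) : Prop :=
  ∀ d : ℕ, Module.finrank K
      ((quotientPiece I d).map (LinearMap.mulLeft K (Ideal.Quotient.mk I L))) =
    min (Module.finrank K (quotientPiece I d)) (Module.finrank K (quotientPiece I (d + 1)))

/-- The weak Lefschetz property of `K[x_1, …, x_n] / I`: multiplication by a generic linear form
has maximal rank in every degree. Generic means: for all coefficient vectors outside the zero
locus of some nonzero polynomial. -/
def HasWLP {K : Type*} [Field K] {n : ℕ} (I : Ideal (MvPolynomial (Fin n) K)) : Prop :=
  ∃ F : MvPolynomial (Fin n) K, F ≠ 0 ∧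
    ∀ c : Fin n → K, eval c F ≠ 0 → HasMaximalRank I (linearForm c)

/-- The exponents of the `m` lexicographically largest monomials of degree `d`
(with `x_1 > x_2 > ⋯ > x_n`): those with fewer than `m` lex-larger monomials of degree `d`. -/
def lexSegment (n d m : ℕ) : Set (Fin n →₀ ℕ) :=
  {a | a.degree = d ∧ {b : Fin n →₀ ℕ | b.degree = d ∧ toLex a < toLex b}.ncard < m}

/-- The span of the `m` lexicographically largest monomials of degree `d`. -/
def lexSpace (K : Type*) [Field K] (n d m : ℕ) : Submodule K (MvPolynomial (Fin n) K) :=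
  Submodule.span K ((fun a => monomial a (1 : K)) '' lexSegment n d m)

/-- The degree `d` component `I_d` of `I`. -/
def idealPiece {K : Type*} [Field K] {n : ℕ} (I : Ideal (MvPolynomial (Fin n) K)) (d : ℕ) :
    Submodule K (MvPolynomial (Fin n) K) :=
  homogeneousSubmodule (Fin n) K d ⊓ I.restrictScalars K

/-- `I` is a Gotzmann ideal: for every `d`, the space `R_1 I_d` has the same dimension as
`R_1 L_d`, where `L_d` is the lex-segment subspace of `R_d` with `dim L_d = dim I_d`. This is the
least dimension allowed by Macaulay's theorem, so each `I_d` has minimal growth. -/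
def IsGotzmann {K : Type*} [Field K] {n : ℕ} (I : Ideal (MvPolynomial (Fin n) K)) : Prop :=
  ∀ d : ℕ,
    Module.finrank K
        (homogeneousSubmodule (Fin n) K 1 * idealPiece I d : Submodule K (MvPolynomial (Fin n) K)) =
      Module.finrank K
        (homogeneousSubmodule (Fin n) K 1 * lexSpace K n d (Module.finrank K (idealPiece I d)) :
          Submodule K (MvPolynomial (Fin n) K))

end

/-! Multiplication by a linear form ℓ on A_d has rank dim R_d − dim (I_{d+1} : ℓ), so the WLP asks
that these colon spaces be small for generic ℓ. Green's theorem
(`eventually_finrank_colonBy_le_numWithLast`) bounds dim (V : ℓ), for a space V of forms of degree d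
and generic ℓ, by `numWithLast`, the number of monomials divisible by the last variable in the lex
segment of size dim V. For V = I_{d+1} this bound depends only on the Hilbert function, and spaces
of minimal growth attain it (`eventually_numWithLast_le_finrank_colonBy`). Hence the WLP of one
Gotzmann algebra yields numerical inequalities in H, and by Green's theorem these force the WLP of
every artinian algebra with Hilbert function H (`hasWLP_of_isGotzmann`). Some Gotzmann algebra
exists for each finite H: by Macaulay's theorem (`lexGrowth_le_finrank_mul`) the lex segments of the
right sizes form an ideal, `lexIdeal`.

Green's theorem is proved by induction on the number of variables and on the degree: for two linear
forms one has ((V : g) : h) = ((V : h) : g), and a violation of the bound contradicts the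
combinatorial inequality `numWithLast_lt_numWithoutLast`. Restriction to a generic hyperplane then
gives Macaulay's theorem by induction on the number of variables, and the strict form of the same
estimate shows that minimal growth forces equality in Green's theorem. -/

open MvPolynomial

noncomputable section

attribute [local instance] MvPolynomial.gradedAlgebra

/-! ### Initial segments of finite sets -/

section UpperSubset

variable {α β : Type*} [LinearOrder β]

/-- `U` is an initial segment of `s` when `s` is listed in decreasing order of `f`. -/
def IsUpperIn (f : α → β) (s U : Finset α) : Prop :=
  U ⊆ s ∧ ∀ a ∈ U, ∀ b ∈ s, f a < f b → b ∈ U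

/-- The number of elements of `s` with a larger value of `f`. -/
def numAbove (f : α → β) (s : Finset α) (a : α) : ℕ := (s.filter fun b => f a < f b).card

/-- The `m` elements of `s` with the largest values of `f`. -/
def topPart (f : α → β) (s : Finset α) (m : ℕ) : Finset α :=
  s.filter fun a => numAbove f s a < m

variable {f : α → β} {s U W : Finset α}

lemma mem_topPart {m : ℕ} {a : α} : a ∈ topPart f s m ↔ a ∈ s ∧ numAbove f s a < m := by
  simp [topPart]

lemma numAbove_lt {a b : α} (hb : b ∈ s) (h : f a < f b) : numAbove f s b < numAbove f s a := by
  apply Finset.card_lt_card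
  rw [Finset.ssubset_iff_of_subset]
  · exact ⟨b, by simp [hb, h], by simp⟩
  · intro x hx
    simp only [Finset.mem_filter] at hx ⊢
    exact ⟨hx.1, h.trans hx.2⟩

lemma isUpperIn_topPart (m : ℕ) : IsUpperIn f s (topPart f s m) := by
  refine ⟨Finset.filter_subset _ _, fun a ha b hb hab => ?_⟩
  rw [mem_topPart] at ha ⊢
  exact ⟨hb, (numAbove_lt hb hab).trans ha.2⟩

lemma topPart_subset (m : ℕ) : topPart f s m ⊆ s := Finset.filter_subset _ _

lemma numAbove_injOn (hf : f.Injective) : Set.InjOn (numAbove f s) s := by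
  intro a ha b hb hab
  rcases lt_trichotomy (f a) (f b) with h | h | h
  · exact absurd hab (numAbove_lt hb h).ne'
  · exact hf h
  · exact absurd hab (numAbove_lt ha h).ne

/-- Distinct elements have distinct positions, all smaller than `s.card`, so every position is
taken. -/
lemma image_numAbove (hf : f.Injective) : s.image (numAbove f s) = Finset.range s.card := by
  apply Finset.eq_of_subset_of_card_le
  · intro i hi
    obtain ⟨a, ha, rfl⟩ := Finset.mem_image.1 hi
    rw [Finset.mem_range]
    apply Finset.card_lt_card
    rw [Finset.ssubset_iff_of_subset (Finset.filter_subset _ _)]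
    exact ⟨a, ha, by simp⟩
  · rw [Finset.card_image_of_injOn (numAbove_injOn hf), Finset.card_range]

lemma card_topPart (hf : f.Injective) {m : ℕ} (hm : m ≤ s.card) : (topPart f s m).card = m := by
  rw [← Finset.card_image_of_injOn ((numAbove_injOn (s := s) hf).mono
    (Finset.coe_subset.2 (topPart_subset m)))]
  conv_rhs => rw [← Finset.card_range m]
  congr 1
  ext i
  simp only [Finset.mem_image, mem_topPart, Finset.mem_range]
  constructor
  · rintro ⟨a, ha, rfl⟩
    exact ha.2
  · intro hi
    have : i ∈ s.image (numAbove f s) := by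
      rw [image_numAbove hf]; exact Finset.mem_range.2 (hi.trans_le hm)
    obtain ⟨a, ha, rfl⟩ := Finset.mem_image.1 this
    exact ⟨a, ⟨ha, hi⟩, rfl⟩

lemma topPart_mono {m m' : ℕ} (h : m ≤ m') : topPart f s m ⊆ topPart f s m' := by
  intro a ha
  rw [mem_topPart] at ha ⊢
  exact ⟨ha.1, ha.2.trans_le h⟩

/-- Two initial segments of a linear order are always comparable, so sizes decide inclusion. -/
lemma IsUpperIn.subset_of_card_le (hf : f.Injective) (hU : IsUpperIn f s U)
    (hW : IsUpperIn f s W) (h : U.card ≤ W.card) : U ⊆ W := by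
  by_contra hUW
  obtain ⟨u, hu, hu'⟩ := Finset.not_subset.1 hUW
  have hWU : W ⊆ U := by
    intro w hw
    rcases lt_trichotomy (f u) (f w) with h | h | h
    · exact hU.2 u hu w (hW.1 hw) h
    · exact absurd (hf h ▸ hw) hu'
    · exact absurd (hW.2 w hw u (hU.1 hu) h) hu'
  exact hu' (Finset.eq_of_subset_of_card_le hWU h ▸ hu)

lemma IsUpperIn.eq_topPart (hf : f.Injective) (hU : IsUpperIn f s U) :
    U = topPart f s U.card := by
  have hc := card_topPart (f := f) hf (Finset.card_le_card hU.1)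
  exact Finset.eq_of_subset_of_card_le
    (hU.subset_of_card_le hf (isUpperIn_topPart _) hc.ge) hc.le

lemma IsUpperIn.subset_of_notMem_of_mem {v : α} (hf : f.Injective) (hU : IsUpperIn f s U)
    (hv : v ∈ s) (hvU : v ∉ U) : ∀ a ∈ U, f v < f a := by
  intro a ha
  rcases lt_trichotomy (f v) (f a) with h | h | h
  · exact h
  · exact absurd (hf h ▸ ha) hvU
  · exact absurd (hU.2 a ha v hv h) hvU

end UpperSubset

/-! ### Lexicographic segments of monomials -/

/-- The exponents of the monomials of degree `d` in the first `n` of countably many variables. -/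
def monomialsOf (n d : ℕ) : Finset (ℕ →₀ ℕ) := Finset.finsuppAntidiag (Finset.range n) d

/-- The first `m` monomials of degree `d` in `n` variables. -/
def lexSeg (n d m : ℕ) : Finset (ℕ →₀ ℕ) := topPart toLex (monomialsOf n d) m

/-- Being a lex segment of monomials of degree `d` in `n` variables. -/
abbrev IsLexSeg (n d : ℕ) (U : Finset (ℕ →₀ ℕ)) : Prop := IsUpperIn toLex (monomialsOf n d) U

lemma mem_monomialsOf {n d : ℕ} {a : ℕ →₀ ℕ} :
    a ∈ monomialsOf n d ↔ (∀ i, n ≤ i → a i = 0) ∧ a.degree = d := by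
  rw [monomialsOf, Finset.mem_finsuppAntidiag]
  have key : a.support ⊆ Finset.range n ↔ ∀ i, n ≤ i → a i = 0 := by
    constructor
    · intro h i hi
      by_contra h0
      exact absurd (Finset.mem_range.1 (h (Finsupp.mem_support_iff.2 h0))) (by lia)
    · intro h i hi
      rw [Finset.mem_range]
      by_contra h0
      exact (Finsupp.mem_support_iff.1 hi) (h i (by lia))
  rw [key, and_comm]
  refine and_congr_right fun h => ?_
  rw [← Finset.sum_subset (key.2 h) (fun x _ hx => Finsupp.notMem_support_iff.1 hx)]
  rfl

lemma monomialsOf_succ_filter (n d : ℕ) :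
    (monomialsOf (n + 1) d).filter (fun a => a n = 0) = monomialsOf n d := by
  ext a
  simp only [Finset.mem_filter, mem_monomialsOf]
  constructor
  · rintro ⟨⟨h1, h2⟩, h3⟩
    refine ⟨fun i hi => ?_, h2⟩
    rcases hi.eq_or_lt with rfl | hi
    · exact h3
    · exact h1 i hi
  · rintro ⟨h1, h2⟩
    exact ⟨⟨fun i hi => h1 i (by lia), h2⟩, h1 n le_rfl⟩

lemma add_single_mem_monomialsOf {n d i : ℕ} {a : ℕ →₀ ℕ} (ha : a ∈ monomialsOf n d)
    (hi : i < n) : a + Finsupp.single i 1 ∈ monomialsOf n (d + 1) := by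
  rw [mem_monomialsOf] at *
  refine ⟨fun j hj => ?_, by simp [ha.2]⟩
  simp [ha.1 j hj, show i ≠ j by lia]

lemma toLex_add_lt_add_iff {ι : Type*} [LinearOrder ι] {a b c : ι →₀ ℕ} :
    toLex (a + c) < toLex (b + c) ↔ toLex a < toLex b := by
  rw [toLex_add, toLex_add, add_lt_add_iff_right]

lemma toLex_lt_iff {ι : Type*} [LinearOrder ι] {a b : ι →₀ ℕ} :
    toLex a < toLex b ↔ ∃ i, (∀ j < i, a j = b j) ∧ a i < b i := by
  rw [Finsupp.Lex.lt_iff]; rfl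

lemma degree_eq_sum_range {n d : ℕ} {a : ℕ →₀ ℕ} (ha : a ∈ monomialsOf n d) :
    ∑ i ∈ Finset.range n, a i = d := by
  rw [monomialsOf, Finset.mem_finsuppAntidiag] at ha
  exact ha.1

/-- The number of monomials without the last variable in a lex segment in `n + 1` variables. -/
def numWithoutLast (n d m : ℕ) : ℕ := ((lexSeg (n + 1) d m).filter fun a => a n = 0).card

/-- The number of monomials with the last variable in a lex segment in `n + 1` variables. -/
def numWithLast (n d m : ℕ) : ℕ := ((lexSeg (n + 1) d m).filter fun a => ¬ a n = 0).card

lemma card_lexSeg {n d m : ℕ} (hm : m ≤ (monomialsOf n d).card) : (lexSeg n d m).card = m :=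
  card_topPart toLex.injective hm

lemma isLexSeg_lexSeg (n d m : ℕ) : IsLexSeg n d (lexSeg n d m) := isUpperIn_topPart m

lemma numWithoutLast_add_numWithLast {n d m : ℕ} (hm : m ≤ (monomialsOf (n + 1) d).card) :
    numWithoutLast n d m + numWithLast n d m = m := by
  rw [numWithoutLast, numWithLast, Finset.card_filter_add_card_filter_not, card_lexSeg hm]

lemma numWithoutLast_mono {n d m m' : ℕ} (h : m ≤ m') :
    numWithoutLast n d m ≤ numWithoutLast n d m' :=
  Finset.card_le_card (Finset.filter_subset_filter _ (topPart_mono h))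

lemma IsLexSeg.filter_last {n d : ℕ} {U : Finset (ℕ →₀ ℕ)} (hU : IsLexSeg (n + 1) d U) :
    IsLexSeg n d (U.filter fun a => a n = 0) := by
  constructor
  · rw [← monomialsOf_succ_filter]
    exact Finset.filter_subset_filter _ hU.1
  · intro a ha b hb hab
    rw [← monomialsOf_succ_filter, Finset.mem_filter] at hb
    rw [Finset.mem_filter] at ha ⊢
    exact ⟨hU.2 a ha.1 b hb.1 hab, hb.2⟩

/-- An initial segment is determined by its size; this is what allows recursion on the number of
variables. -/
lemma lexSeg_filter_last (n d m : ℕ) :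
    (lexSeg (n + 1) d m).filter (fun a => a n = 0) = lexSeg n d (numWithoutLast n d m) :=
  (isLexSeg_lexSeg (n + 1) d m).filter_last.eq_topPart toLex.injective

/-- The monomials of degree `d` whose product with the last variable lies in `U`. -/
def divLast (n d : ℕ) (U : Finset (ℕ →₀ ℕ)) : Finset (ℕ →₀ ℕ) :=
  (monomialsOf (n + 1) d).filter fun w => w + Finsupp.single n 1 ∈ U

lemma IsLexSeg.divLast {n d : ℕ} {U : Finset (ℕ →₀ ℕ)} (hU : IsLexSeg (n + 1) (d + 1) U) :
    IsLexSeg (n + 1) d (divLast n d U) := by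
  refine ⟨Finset.filter_subset _ _, fun a ha b hb hab => ?_⟩
  rw [_root_.divLast, Finset.mem_filter] at ha ⊢
  exact ⟨hb, hU.2 _ ha.2 _ (add_single_mem_monomialsOf hb (by lia)) (toLex_add_lt_add_iff.2 hab)⟩

lemma exists_eq_add_single {n d : ℕ} {a : ℕ →₀ ℕ} (ha : a ∈ monomialsOf n (d + 1)) {i : ℕ}
    (hi : a i ≠ 0) : ∃ b ∈ monomialsOf n d, a = b + Finsupp.single i 1 := by
  have hle : Finsupp.single i 1 ≤ a := by
    rw [Finsupp.single_le_iff]; lia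
  have h : a = (a - Finsupp.single i 1) + Finsupp.single i 1 := (tsub_add_cancel_of_le hle).symm
  refine ⟨a - Finsupp.single i 1, ?_, h⟩
  rw [mem_monomialsOf] at ha ⊢
  refine ⟨fun j hj => by simp [ha.1 j hj], ?_⟩
  have h2 := ha.2
  rw [h] at h2
  simpa using h2

lemma card_divLast {n d : ℕ} {U : Finset (ℕ →₀ ℕ)} (hU : U ⊆ monomialsOf (n + 1) (d + 1)) :
    (divLast n d U).card = (U.filter fun a => ¬ a n = 0).card := by
  apply Finset.card_bij (fun w _ => w + Finsupp.single n 1)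
  · intro a ha
    rw [divLast, Finset.mem_filter] at ha
    simp [ha.2]
  · intro a _ b _ h
    exact add_right_cancel h
  · intro a ha
    rw [Finset.mem_filter] at ha
    obtain ⟨b, hb, rfl⟩ := exists_eq_add_single (hU ha.1) ha.2
    exact ⟨b, by simp [divLast, hb, ha.1], rfl⟩

lemma card_divLast_lexSeg (n d m : ℕ) :
    (divLast n d (lexSeg (n + 1) (d + 1) m)).card = numWithLast n (d + 1) m :=
  card_divLast (topPart_subset m)

/-- Replace the variable `n + 1` by the variable `n`. -/
def moveLast (n : ℕ) (v : ℕ →₀ ℕ) : ℕ →₀ ℕ := v.erase (n + 1) + Finsupp.single n (v (n + 1))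

lemma moveLast_mem {n d : ℕ} {v : ℕ →₀ ℕ} (hv : v ∈ monomialsOf (n + 2) d) :
    moveLast n v ∈ monomialsOf (n + 1) d := by
  have hd : moveLast n v + Finsupp.single (n + 1) (v (n + 1)) =
      v + Finsupp.single n (v (n + 1)) := by
    rw [moveLast, add_right_comm, Finsupp.erase_add_single]
  rw [mem_monomialsOf] at hv ⊢
  constructor
  · intro i hi
    rcases hi.eq_or_lt with rfl | hi
    · simp [moveLast]
    · simp [moveLast, hv.1 i hi, Finsupp.erase_ne (show i ≠ n + 1 by lia),
        show n ≠ i by lia]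
  · have := congrArg Finsupp.degree hd
    simp only [map_add, Finsupp.degree_single] at this
    lia

lemma moveLast_apply_of_lt {n i : ℕ} (hi : i < n) (v : ℕ →₀ ℕ) : moveLast n v i = v i := by
  simp [moveLast, Finsupp.erase_ne (show i ≠ n + 1 by lia), show n ≠ i by lia]

lemma le_moveLast (n : ℕ) (v : ℕ →₀ ℕ) : toLex v ≤ toLex (moveLast n v) := by
  by_cases h : v (n + 1) = 0
  · have : moveLast n v = v := by
      rw [moveLast, h, Finsupp.single_zero, add_zero, Finsupp.erase_of_notMem_support]
      simpa using h
    rw [this]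
  · refine (toLex_lt_iff.2 ⟨n, fun j hj => (moveLast_apply_of_lt hj v).symm, ?_⟩).le
    simp [moveLast]
    lia

/-- If `z` does not involve the variable `n + 1` and exceeds `v * x_{n+1}`, then it is at least
`moveLast n v * x_n`. -/
lemma moveLast_add_le {n d : ℕ} {v z : ℕ →₀ ℕ} (hv : v ∈ monomialsOf (n + 2) d)
    (hz : z ∈ monomialsOf (n + 1) (d + 1))
    (h : toLex (v + Finsupp.single (n + 1) 1) < toLex z) :
    toLex (moveLast n v + Finsupp.single n 1) ≤ toLex z := by
  by_contra hlt
  rw [not_le, toLex_lt_iff] at hlt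
  obtain ⟨i, hi, hi'⟩ := hlt
  have hu := add_single_mem_monomialsOf (moveLast_mem hv) (Nat.lt_succ_self n)
  have hin : i ≤ n := by
    by_contra hin
    have := (mem_monomialsOf.1 hu).1 i (by lia)
    lia
  rcases hin.lt_or_eq with hin | rfl
  -- Before the variable `n` the monomials `v` and `moveLast n v` agree, so `z` would be smaller
  -- than `v * x_{n+1}`.
  · refine absurd h (not_lt.2 (toLex_lt_iff.2 ⟨i, fun j hj => ?_, ?_⟩).le)
    · rw [hi j hj]
      simp [moveLast_apply_of_lt (hj.trans hin), show n ≠ j by lia,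
        show n + 1 ≠ j by lia]
    · refine hi'.trans_eq ?_
      simp [moveLast_apply_of_lt hin, show n ≠ i by lia,
        show n + 1 ≠ i by lia]
  -- Both monomials have the same degree and agree before `x_n`, their last variable, so they also
  -- agree there.
  · have h1 := degree_eq_sum_range hz
    have h2 := degree_eq_sum_range hu
    rw [Finset.sum_range_succ] at h1 h2
    rw [Finset.sum_congr rfl fun j hj => hi j (Finset.mem_range.1 hj)] at h1
    lia

/-- The numerical inequality behind Green's hyperplane restriction theorem. -/
theorem numWithLast_lt_numWithoutLast {n d m r : ℕ}
    (hm : m ≤ (monomialsOf (n + 2) (d + 1)).card) (hr : r < numWithoutLast (n + 1) (d + 1) m)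
    (hmr : m - r ≤ (monomialsOf (n + 2) d).card) :
    numWithLast n (d + 1) r < numWithoutLast (n + 1) d (m - r) := by
  have hsum := numWithoutLast_add_numWithLast hm
  -- Since `r` is less than the number of monomials without the last variable, `m - r` exceeds the
  -- number with it.
  obtain ⟨v, hvT, hvW⟩ : ∃ v ∈ lexSeg (n + 2) d (m - r),
      v ∉ divLast (n + 1) d (lexSeg (n + 2) (d + 1) m) := by
    apply Finset.exists_mem_notMem_of_card_lt_card
    rw [card_divLast_lexSeg, card_lexSeg hmr]
    lia
  have hv : v ∈ monomialsOf (n + 2) d := topPart_subset _ hvT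
  have hvL : v + Finsupp.single (n + 1) 1 ∉ lexSeg (n + 2) (d + 1) m := fun h =>
    hvW (Finset.mem_filter.2 ⟨hv, h⟩)
  have hL := (isLexSeg_lexSeg (n + 2) (d + 1) m).subset_of_notMem_of_mem toLex.injective
    (add_single_mem_monomialsOf hv (by lia)) hvL
  have hA := (isLexSeg_lexSeg (n + 2) (d + 1) m).filter_last
  have hrN : r ≤ (monomialsOf (n + 1) (d + 1)).card := hr.le.trans (Finset.card_le_card hA.1)
  obtain ⟨z, hz, hz'⟩ : ∃ z ∈ (lexSeg (n + 2) (d + 1) m).filter (fun a => a (n + 1) = 0),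
      z ∉ lexSeg (n + 1) (d + 1) r := by
    apply Finset.exists_mem_notMem_of_card_lt_card
    rw [card_lexSeg hrN]
    exact hr
  have hzP := hA.1 hz
  have hzle := moveLast_add_le hv hzP (hL z (Finset.mem_filter.1 hz).1)
  -- Here `w * x_n > z ≥ moveLast n v * x_n`, and `x_n` cancels.
  have hB : ∀ w ∈ divLast n d (lexSeg (n + 1) (d + 1) r), toLex (moveLast n v) < toLex w := by
    intro w hw
    have := (isLexSeg_lexSeg (n + 1) (d + 1) r).subset_of_notMem_of_mem toLex.injective hzP hz' _
      (Finset.mem_filter.1 hw).2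
    exact toLex_add_lt_add_iff.1 (hzle.trans_lt this)
  have hT : ∀ w ∈ monomialsOf (n + 1) d, toLex v ≤ toLex w →
      w ∈ (lexSeg (n + 2) d (m - r)).filter (fun a => a (n + 1) = 0) := by
    intro w hw hvw
    rw [← monomialsOf_succ_filter, Finset.mem_filter] at hw
    refine Finset.mem_filter.2 ⟨?_, hw.2⟩
    rcases hvw.lt_or_eq with h | h
    · exact (isLexSeg_lexSeg (n + 2) d (m - r)).2 v hvT w hw.1 h
    · exact toLex.injective h ▸ hvT
  -- The inclusion of the two sets being counted is strict because `moveLast n v` lies only in the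
  -- larger one.
  rw [← card_divLast_lexSeg]
  apply Finset.card_lt_card
  rw [Finset.ssubset_iff_of_subset]
  · exact ⟨moveLast n v, hT _ (moveLast_mem hv) (le_moveLast n v), fun h => (hB _ h).false⟩
  · intro w hw
    exact hT w (Finset.mem_filter.1 hw).1 ((le_moveLast n v).trans (hB w hw).le)

/-! ### Shadows of lex segments -/

/-- The monomials obtained by multiplying those in `U` by one of the first `n` variables. -/
def shadowOf (n : ℕ) (U : Finset (ℕ →₀ ℕ)) : Finset (ℕ →₀ ℕ) :=
  Finset.image₂ (fun a i => a + Finsupp.single i 1) U (Finset.range n)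

/-- The number of monomials in the shadow of a lex segment. -/
def lexGrowth (n d m : ℕ) : ℕ := (shadowOf n (lexSeg n d m)).card

lemma mem_shadowOf {n : ℕ} {U : Finset (ℕ →₀ ℕ)} {b : ℕ →₀ ℕ} :
    b ∈ shadowOf n U ↔ ∃ a ∈ U, ∃ i < n, a + Finsupp.single i 1 = b := by
  simp [shadowOf]

lemma shadowOf_subset {n d : ℕ} {U : Finset (ℕ →₀ ℕ)} (hU : U ⊆ monomialsOf n d) :
    shadowOf n U ⊆ monomialsOf n (d + 1) := by
  intro b hb
  obtain ⟨a, ha, i, hi, rfl⟩ := mem_shadowOf.1 hb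
  exact add_single_mem_monomialsOf (hU ha) hi

lemma toLex_single_le {i j : ℕ} (h : i ≤ j) :
    toLex (Finsupp.single j 1 : ℕ →₀ ℕ) ≤ toLex (Finsupp.single i 1) :=
  Finsupp.Lex.single_le_iff.2 h

lemma toLex_add_single_le {i j : ℕ} (h : i ≤ j) (a : ℕ →₀ ℕ) :
    toLex (a + Finsupp.single j 1) ≤ toLex (a + Finsupp.single i 1) := by
  rw [toLex_add, toLex_add]
  exact add_le_add_right (toLex_single_le h) _

/-- Only multiples by the last variable of elements of a lex segment are divisible by it. -/
lemma IsLexSeg.divLast_shadowOf {n d : ℕ} {U : Finset (ℕ →₀ ℕ)} (hU : IsLexSeg (n + 1) d U) :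
    _root_.divLast n d (shadowOf (n + 1) U) = U := by
  ext w
  rw [_root_.divLast, Finset.mem_filter, mem_shadowOf]
  constructor
  · rintro ⟨hw, a, ha, i, hi, h⟩
    have : toLex a ≤ toLex w := by
      by_contra hlt
      have h1 := toLex_add_single_le (show i ≤ n by lia) a
      rw [h] at h1
      have h2 := toLex_add_lt_add_iff (c := Finsupp.single n 1).2 (not_le.1 hlt)
      exact absurd (h1.trans_lt h2) (lt_irrefl _)
    rcases this.lt_or_eq with h | h
    · exact hU.2 a ha w hw h
    · exact toLex.injective h ▸ ha
  · intro hw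
    exact ⟨hU.1 hw, w, hw, n, by lia, rfl⟩

lemma shadowOf_filter_last (n : ℕ) (U : Finset (ℕ →₀ ℕ)) :
    (shadowOf (n + 1) U).filter (fun a => a n = 0) = shadowOf n (U.filter fun a => a n = 0) := by
  ext b
  simp only [Finset.mem_filter, mem_shadowOf]
  constructor
  · rintro ⟨⟨a, ha, i, hi, rfl⟩, h⟩
    simp only [Finsupp.add_apply, Nat.add_eq_zero_iff] at h
    refine ⟨a, ⟨ha, h.1⟩, i, ?_, rfl⟩
    by_contra h0
    obtain rfl : i = n := by lia
    simp at h
  · rintro ⟨a, ⟨ha, h⟩, i, hi, rfl⟩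
    refine ⟨⟨a, ha, i, by lia, rfl⟩, ?_⟩
    simp [h, show i ≠ n by lia]

/-- The multiples of `x_n` in the shadow are exactly the `m` products of `x_n` with the segment; the
rest is the shadow, in one variable fewer, of the part free of `x_n`. -/
lemma lexGrowth_succ {n d m : ℕ} (hm : m ≤ (monomialsOf (n + 1) d).card) :
    lexGrowth (n + 1) d m = m + lexGrowth n d (numWithoutLast n d m) := by
  have hU := isLexSeg_lexSeg (n + 1) d m
  rw [lexGrowth, ← Finset.card_filter_add_card_filter_not (fun a => a n = 0),
    shadowOf_filter_last, lexSeg_filter_last, ← card_divLast (shadowOf_subset hU.1),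
    hU.divLast_shadowOf, card_lexSeg hm, add_comm, lexGrowth]

lemma lexGrowth_mono {n d m m' : ℕ} (h : m ≤ m') : lexGrowth n d m ≤ lexGrowth n d m' :=
  Finset.card_le_card (Finset.image₂_subset_right (topPart_mono h))

/-- At least one variable is needed: in zero variables every shadow is empty. -/
lemma lexGrowth_lt {n d m m' : ℕ} (h : m < m') (hm' : m' ≤ (monomialsOf (n + 1) d).card) :
    lexGrowth (n + 1) d m < lexGrowth (n + 1) d m' := by
  rw [lexGrowth_succ hm', lexGrowth_succ (h.le.trans hm')]
  exact add_lt_add_of_lt_of_le h (lexGrowth_mono (numWithoutLast_mono h.le))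

lemma IsLexSeg.shadowOf {n d : ℕ} {U : Finset (ℕ →₀ ℕ)} (hU : IsLexSeg n d U) :
    IsLexSeg n (d + 1) (shadowOf n U) := by
  refine ⟨shadowOf_subset hU.1, fun b hb z hz hbz => ?_⟩
  obtain ⟨a, ha, i, hi, rfl⟩ := mem_shadowOf.1 hb
  rcases n with _ | n
  · lia
  have haP := hU.1 ha
  replace hbz := (toLex_add_single_le (show i ≤ n by lia) a).trans_lt hbz
  have hz0 : z.support.Nonempty := by
    rw [Finsupp.support_nonempty_iff]
    rintro rfl
    simpa using (mem_monomialsOf.1 hz).2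
  -- With `x_k` the last variable dividing `z`, the quotient `z / x_k` will be shown to lie in `U`.
  obtain ⟨k, hk, hkmax⟩ : ∃ k, z k ≠ 0 ∧ ∀ j, k < j → z j = 0 := by
    refine ⟨z.support.max' hz0, Finsupp.mem_support_iff.1 (z.support.max'_mem hz0), ?_⟩
    intro j hj
    by_contra h0
    exact absurd (z.support.le_max' j (Finsupp.mem_support_iff.2 h0)) (by lia)
  have hkn : k < n + 1 := by
    by_contra h0
    exact hk ((mem_monomialsOf.1 hz).1 k (by lia))
  obtain ⟨y, hy, rfl⟩ := exists_eq_add_single hz hk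
  refine mem_shadowOf.2 ⟨y, ?_, k, hkn, rfl⟩
  have hle : toLex a ≤ toLex y := by
    by_contra hlt
    rw [not_le, toLex_lt_iff] at hlt
    obtain ⟨j, hj, hj'⟩ := hlt
    rcases lt_or_ge j k with hjk | hjk
    -- The factors `x_k` and `x_n` do not affect the exponents up to `j`, so `z` would be below `a *
    -- x_n`.
    · refine absurd hbz (not_lt.2 (toLex_lt_iff.2 ⟨j, fun l hl => ?_, ?_⟩).le)
      · simp [hj l hl, show k ≠ l by lia, show n ≠ l by lia]
      · simpa [Finsupp.single_apply, show k ≠ j by lia, show n ≠ j by lia] using hj'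
    -- Past `j ≥ k` the exponents of `y` vanish, so `y` is at most `a` everywhere and smaller at
    -- `j`, against equality of degrees.
    · have h1 := degree_eq_sum_range hy
      have h2 := degree_eq_sum_range haP
      have : ∑ l ∈ Finset.range (n + 1), y l < ∑ l ∈ Finset.range (n + 1), a l := by
        apply Finset.sum_lt_sum
        · intro l _
          rcases lt_trichotomy l j with h | rfl | h
          · exact (hj l h).le
          · exact hj'.le
          · have := hkmax l (by lia)
            simp only [Finsupp.add_apply, Nat.add_eq_zero_iff] at this
            lia
        · refine ⟨j, ?_, hj'⟩
          rw [Finset.mem_range]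
          by_contra h0
          have := (mem_monomialsOf.1 haP).1 j (by lia)
          lia
      lia
  rcases hle.lt_or_eq with h | h
  · exact hU.2 a ha y hy h
  · exact toLex.injective h ▸ ha

/-- The shadow of a lex segment lies in every lex segment that is at least as large. -/
lemma shadowOf_lexSeg_subset {n d m m' : ℕ} (h : lexGrowth n d m ≤ m')
    (hm' : m' ≤ (monomialsOf n (d + 1)).card) :
    shadowOf n (lexSeg n d m) ⊆ lexSeg n (d + 1) m' :=
  (isLexSeg_lexSeg n d m).shadowOf.subset_of_card_le toLex.injective (isLexSeg_lexSeg _ _ _)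
    (h.trans_eq (card_lexSeg hm').symm)

/-! ### Generic coefficient vectors -/

section Generic

variable {K : Type*} [Field K]

/-- The filter of sets of vectors that contain the complement of a hypersurface. -/
def genericFilter (K : Type*) [Field K] (n : ℕ) : Filter (Fin n → K) where
  sets := {U | ∃ F : MvPolynomial (Fin n) K, F ≠ 0 ∧ ∀ c, eval c F ≠ 0 → c ∈ U}
  univ_sets := ⟨1, one_ne_zero, fun _ _ => trivial⟩
  sets_of_superset := by
    rintro U W ⟨F, hF, hU⟩ hUW
    exact ⟨F, hF, fun c hc => hUW (hU c hc)⟩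
  inter_sets := by
    rintro U W ⟨F, hF, hU⟩ ⟨G, hG, hW⟩
    refine ⟨F * G, mul_ne_zero hF hG, fun c hc => ?_⟩
    rw [map_mul, mul_ne_zero_iff] at hc
    exact ⟨hU c hc.1, hW c hc.2⟩

lemma eventually_generic_iff {n : ℕ} {p : (Fin n → K) → Prop} :
    (∀ᶠ c in genericFilter K n, p c) ↔
      ∃ F : MvPolynomial (Fin n) K, F ≠ 0 ∧ ∀ c, eval c F ≠ 0 → p c := Iff.rfl

lemma exists_eval_ne_zero [Infinite K] {n : ℕ} {F : MvPolynomial (Fin n) K} (hF : F ≠ 0) :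
    ∃ c, eval c F ≠ 0 := by
  by_contra! h
  exact hF (MvPolynomial.funext fun c => by rw [h c, map_zero])

instance genericFilter_neBot [Infinite K] (n : ℕ) : (genericFilter K n).NeBot := by
  refine ⟨fun h => ?_⟩
  have : ∀ᶠ c in genericFilter K n, False := by rw [h]; exact Filter.eventually_bot
  obtain ⟨F, hF, hc⟩ := eventually_generic_iff.1 this
  obtain ⟨c, hc'⟩ := exists_eval_ne_zero hF
  exact hc c hc'

lemma eventually_generic_last_ne_zero (K : Type*) [Field K] (n : ℕ) :
    ∀ᶠ c in genericFilter K (n + 1), c (Fin.last n) ≠ 0 :=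
  eventually_generic_iff.2 ⟨X (Fin.last n), X_ne_zero _, fun c hc => by simpa using hc⟩

/-- A polynomial whose value at `c` is the `i`th coordinate of `f c`. -/
lemma eval_sum_C_mul_X {n : ℕ} (f : (Fin n → K) →ₗ[K] K) (c : Fin n → K) :
    eval c (∑ k, C (f (Pi.single k 1)) * X k) = f c := by
  conv_rhs => rw [LinearMap.pi_apply_eq_sum_univ f c]
  simp only [map_sum, map_mul, eval_C, eval_X, smul_eq_mul]
  refine Finset.sum_congr rfl fun k _ => ?_
  rw [mul_comm]
  congr 2
  ext j
  simp [Pi.single_apply, eq_comm]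

lemma tendsto_genericFilter [Infinite K] {m n : ℕ} (f : (Fin n → K) →ₗ[K] (Fin m → K))
    (hf : Function.Surjective f) :
    Filter.Tendsto f (genericFilter K n) (genericFilter K m) := by
  rintro U ⟨F, hF, hU⟩
  let G : MvPolynomial (Fin n) K :=
    aeval (fun i => ∑ k, C (((LinearMap.proj i).comp f) (Pi.single k 1)) * X k) F
  have key : ∀ c, eval c G = eval (f c) F := by
    intro c
    rw [← aeval_eq_eval, ← AlgHom.comp_apply, comp_aeval]
    have : (fun i => aeval c (∑ k, C (((LinearMap.proj i).comp f) (Pi.single k 1)) *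
        (X k : MvPolynomial (Fin n) K))) = f c := by
      ext i
      rw [aeval_eq_eval]
      exact eval_sum_C_mul_X ((LinearMap.proj i).comp f) c
    rw [this]
    rfl
  refine ⟨G, fun h0 => ?_, fun c hc => hU _ (key c ▸ hc)⟩
  -- Surjectivity turns a point where `F` does not vanish into one where its pullback `G` does not
  -- vanish.
  · obtain ⟨b, hb⟩ := exists_eval_ne_zero hF
    obtain ⟨c, rfl⟩ := hf b
    rw [← key, h0, map_zero] at hb
    exact hb rfl

/-- The determinant of a matrix of linear functionals is a polynomial function. -/
lemma exists_eval_eq_det {n r : ℕ} (f : Fin r → Fin r → (Fin n → K) →ₗ[K] K) :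
    ∃ F : MvPolynomial (Fin n) K, ∀ c, eval c F = (Matrix.of fun i j => f i j c).det := by
  refine ⟨(Matrix.of fun i j => ∑ k, C (f i j (Pi.single k 1)) * X k).det, fun c => ?_⟩
  rw [RingHom.map_det]
  refine congrArg Matrix.det (Matrix.ext fun i j => ?_)
  rw [RingHom.mapMatrix_apply, Matrix.map_apply, Matrix.of_apply, Matrix.of_apply,
    eval_sum_C_mul_X]

lemma exists_dual_family {U ι : Type*} [AddCommGroup U] [Module K U] [Fintype ι] [DecidableEq ι]
    {u : ι → U} (hu : LinearIndependent K u) :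
    ∃ g : U →ₗ[K] (ι → K), ∀ i, g (u i) = Pi.single i 1 := by
  obtain ⟨g, hg⟩ := LinearMap.exists_leftInverse_of_injective (Fintype.linearCombination K u)
    (LinearMap.ker_eq_bot.2 hu.fintypeLinearCombination_injective)
  refine ⟨g, fun i => ?_⟩
  have := LinearMap.congr_fun hg (Pi.single i 1)
  simpa using this

/-- In a linear family of linear maps the dimension of the kernel is generically smallest. -/
theorem eventually_finrank_ker_le {n : ℕ} {W U : Type*} [AddCommGroup W] [Module K W]
    [FiniteDimensional K W] [AddCommGroup U] [Module K U]
    (T : (Fin n → K) →ₗ[K] W →ₗ[K] U) (c₀ : Fin n → K) :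
    ∀ᶠ c in genericFilter K n,
      Module.finrank K (LinearMap.ker (T c)) ≤ Module.finrank K (LinearMap.ker (T c₀)) := by
  -- Lower semicontinuity of the rank: preimages `w` of a basis of the range at `c₀`, with
  -- functionals dual to their images, give a minor of `T c` that is polynomial in `c` and equals 1
  -- at `c₀`. Where it is non-zero, the rank is at least that of `T c₀`.
  let b := Module.finBasis K (LinearMap.range (T c₀))
  have hb : ∀ i, ∃ w, T c₀ w = b i := fun i => (b i).2
  choose w hw using hb
  have hu : LinearIndependent K fun i => T c₀ (w i) := by
    have h := b.linearIndependent.map' (LinearMap.range (T c₀)).subtype (Submodule.ker_subtype _)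
    have hbw : (LinearMap.range (T c₀)).subtype ∘ b = fun i => T c₀ (w i) :=
      funext fun i => (hw i).symm
    rwa [hbw] at h
  obtain ⟨g, hg⟩ := exists_dual_family hu
  obtain ⟨F, hF⟩ := exists_eval_eq_det fun i j =>
    (LinearMap.proj j).comp (g.comp ((LinearMap.applyₗ (w i)).comp T))
  have hF' : ∀ c, eval c F = (Matrix.of fun i => g (T c (w i))).det := hF
  refine eventually_generic_iff.2 ⟨F, ?_, fun c hc => ?_⟩
  · rintro rfl
    have h1 := hF' c₀
    have h2 : (Matrix.of fun i => g (T c₀ (w i))) = 1 := by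
      ext i j
      rw [Matrix.of_apply, hg, Matrix.one_apply, Pi.single_apply]
      simp [eq_comm]
    rw [map_zero, h2, Matrix.det_one] at h1
    exact zero_ne_one h1
  · rw [hF'] at hc
    have h0 : LinearIndependent K (g ∘ fun i => T c (w i)) :=
      Matrix.linearIndependent_rows_of_det_ne_zero (A := Matrix.of fun i => g (T c (w i))) hc
    have h1 : LinearIndependent K fun i => T c (w i) := LinearIndependent.of_comp g h0
    have h2 : LinearIndependent K (fun i => (⟨T c (w i), ⟨w i, rfl⟩⟩ : LinearMap.range (T c))) :=
      LinearIndependent.of_comp (LinearMap.range (T c)).subtype h1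
    have h3 := h2.fintype_card_le_finrank
    rw [Fintype.card_fin] at h3
    have h4 := LinearMap.finrank_range_add_finrank_ker (T c)
    have h5 := LinearMap.finrank_range_add_finrank_ker (T c₀)
    lia

end Generic

/-! ### Colon spaces and restriction to a hyperplane -/

section Restriction

variable {K : Type*} [Field K] {n : ℕ}

instance finiteDimensional_homogeneousSubmodule (n d : ℕ) :
    FiniteDimensional K (homogeneousSubmodule (Fin n) K d) :=
  Module.Finite.iff_fg.2 (homogeneousSubmodule_fg (Fin n) K d)

lemma finiteDimensional_of_le_homogeneous {d : ℕ} {V : Submodule K (MvPolynomial (Fin n) K)}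
    (hV : V ≤ homogeneousSubmodule (Fin n) K d) : FiniteDimensional K V :=
  Submodule.finiteDimensional_of_le hV

/-- The polynomials whose product with `g` lies in `V`. -/
def colonBy (V : Submodule K (MvPolynomial (Fin n) K)) (g : MvPolynomial (Fin n) K) :
    Submodule K (MvPolynomial (Fin n) K) :=
  V.comap (LinearMap.mulLeft K g)

@[simp] lemma mem_colonBy {V : Submodule K (MvPolynomial (Fin n) K)}
    {g w : MvPolynomial (Fin n) K} : w ∈ colonBy V g ↔ g * w ∈ V := Iff.rfl

/-- This symmetry lets the induction for Green's theorem exchange a fixed linear form with a generic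
one. -/
lemma colonBy_comm (V : Submodule K (MvPolynomial (Fin n) K)) (g h : MvPolynomial (Fin n) K) :
    colonBy (colonBy V g) h = colonBy (colonBy V h) g := by
  ext w
  simp only [mem_colonBy, mul_left_comm]

lemma linearForm_add (a b : Fin n → K) : linearForm (a + b) = linearForm a + linearForm b := by
  simp [linearForm, add_mul, Finset.sum_add_distrib]

lemma linearForm_smul (t : K) (a : Fin n → K) : linearForm (t • a) = t • linearForm a := by
  simp [linearForm, Finset.smul_sum, smul_eq_C_mul, mul_assoc]

lemma isHomogeneous_linearForm (c : Fin n → K) : (linearForm c).IsHomogeneous 1 :=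
  IsHomogeneous.sum _ _ _ fun _ _ => isHomogeneous_C_mul_X _ _

lemma linearForm_ne_zero {c : Fin (n + 1) → K} (hc : c (Fin.last n) ≠ 0) : linearForm c ≠ 0 := by
  intro h
  have := congrArg (eval (Pi.single (Fin.last n) 1)) h
  simp [linearForm, Pi.single_apply] at this
  exact hc this

lemma homogeneousComponent_mul_of_isHomogeneous {g : MvPolynomial (Fin n) K}
    (hg : g.IsHomogeneous 1) (w : MvPolynomial (Fin n) K) (j : ℕ) :
    homogeneousComponent (1 + j) (g * w) = g * homogeneousComponent j w :=
by
  conv_lhs => rw [← sum_homogeneousComponent w, Finset.mul_sum, map_sum]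
  have h : ∀ i, homogeneousComponent (1 + j) (g * homogeneousComponent i w) =
      if j = i then g * homogeneousComponent i w else 0 := by
    intro i
    rw [homogeneousComponent_of_mem (hg.mul (homogeneousComponent_isHomogeneous i w))]
    simp
  simp only [h, Finset.sum_ite_eq, Finset.mem_range]
  split_ifs with hj
  · rfl
  · rw [homogeneousComponent_eq_zero j w (by lia), mul_zero]

lemma isHomogeneous_of_components {w : MvPolynomial (Fin n) K} {d : ℕ}
    (h : ∀ j, j ≠ d → homogeneousComponent j w = 0) : w.IsHomogeneous d := by
  have : w = homogeneousComponent d w := by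
    conv_lhs => rw [← sum_homogeneousComponent w]
    by_cases hd : d ∈ Finset.range (w.totalDegree + 1)
    · exact Finset.sum_eq_single_of_mem d hd fun j _ hj => h j hj
    · rw [homogeneousComponent_eq_zero d w (by simpa using hd)]
      exact Finset.sum_eq_zero fun j hj => h j fun e => hd (e ▸ hj)
  rw [this]
  exact homogeneousComponent_isHomogeneous d w

lemma homogeneousComponent_of_isHomogeneous {w : MvPolynomial (Fin n) K} {d j : ℕ}
    (h : w.IsHomogeneous d) (hj : j ≠ d) : homogeneousComponent j w = 0 := by
  rw [homogeneousComponent_of_mem h, if_neg hj]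

/-- Each component of `w` of degree other than `d` is annihilated by `g`, and the polynomial ring is
a domain. So the colon, taken in the whole ring, is already a space of forms. -/
lemma colonBy_le {d : ℕ} {V : Submodule K (MvPolynomial (Fin n) K)}
    (hV : V ≤ homogeneousSubmodule (Fin n) K (d + 1)) {g : MvPolynomial (Fin n) K}
    (hg : g.IsHomogeneous 1) (hg0 : g ≠ 0) : colonBy V g ≤ homogeneousSubmodule (Fin n) K d := by
  intro w hw
  refine isHomogeneous_of_components fun j hj => ?_
  have := homogeneousComponent_mul_of_isHomogeneous hg w j
  rw [homogeneousComponent_of_isHomogeneous (w := g * w) (hV hw) (by lia)] at this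
  exact (mul_eq_zero.1 this.symm).resolve_left hg0

lemma colonBy_eq_bot {V : Submodule K (MvPolynomial (Fin n) K)}
    (hV : V ≤ homogeneousSubmodule (Fin n) K 0) {g : MvPolynomial (Fin n) K}
    (hg : g.IsHomogeneous 1) (hg0 : g ≠ 0) : colonBy V g = ⊥ := by
  rw [eq_bot_iff]
  intro w hw
  rw [Submodule.mem_bot, ← sum_homogeneousComponent w]
  refine Finset.sum_eq_zero fun j _ => ?_
  have := homogeneousComponent_mul_of_isHomogeneous hg w j
  rw [homogeneousComponent_of_isHomogeneous (w := g * w) (hV hw) (by lia)] at this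
  exact (mul_eq_zero.1 this.symm).resolve_left hg0

/-- Multiplication of forms of degree `d` by a variable linear form, modulo `V`. -/
def mulLinearFormMod (d : ℕ) (V : Submodule K (MvPolynomial (Fin n) K)) :
    (Fin n → K) →ₗ[K] homogeneousSubmodule (Fin n) K d →ₗ[K] MvPolynomial (Fin n) K ⧸ V :=
  LinearMap.mk₂ K (fun c w => V.mkQ (linearForm c * w))
    (fun a b w => by rw [linearForm_add, add_mul, map_add])
    (fun t a w => by rw [linearForm_smul, smul_mul_assoc, map_smul])
    (fun _ v w => by rw [Submodule.coe_add, mul_add, map_add])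
    (fun t _ w => by rw [Submodule.coe_smul, mul_smul_comm, map_smul])

lemma finrank_ker_mulLinearFormMod {d : ℕ} {V : Submodule K (MvPolynomial (Fin n) K)}
    (c : Fin n → K) :
    Module.finrank K (LinearMap.ker (mulLinearFormMod d V c)) =
      Module.finrank K (homogeneousSubmodule (Fin n) K d ⊓ colonBy V (linearForm c) :
        Submodule K (MvPolynomial (Fin n) K)) := by
  have : LinearMap.ker (mulLinearFormMod d V c) =
      (colonBy V (linearForm c)).comap (homogeneousSubmodule (Fin n) K d).subtype := by
    ext w
    simp [mulLinearFormMod, Submodule.Quotient.mk_eq_zero]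
  rw [this, ← Submodule.map_comap_subtype, Submodule.finrank_map_subtype_eq]

/-- For a generic linear form the colon space is as small as possible. -/
lemma eventually_finrank_colonBy_le {d : ℕ} {V : Submodule K (MvPolynomial (Fin (n + 1)) K)}
    (hV : V ≤ homogeneousSubmodule (Fin (n + 1)) K (d + 1)) {c₀ : Fin (n + 1) → K}
    (hc₀ : c₀ (Fin.last n) ≠ 0) :
    ∀ᶠ c in genericFilter K (n + 1), Module.finrank K (colonBy V (linearForm c)) ≤
      Module.finrank K (colonBy V (linearForm c₀)) := by
  filter_upwards [eventually_finrank_ker_le (mulLinearFormMod d V) c₀,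
    eventually_generic_last_ne_zero K n] with c hc hc'
  rw [finrank_ker_mulLinearFormMod, finrank_ker_mulLinearFormMod,
    inf_eq_right.2 (colonBy_le hV (isHomogeneous_linearForm c) (linearForm_ne_zero hc')),
    inf_eq_right.2 (colonBy_le hV (isHomogeneous_linearForm c₀) (linearForm_ne_zero hc₀))] at hc
  exact hc

/-- The restriction of polynomials to the hyperplane where `linearForm c` vanishes, obtained by
solving for the last variable. -/
def restrictTo (c : Fin (n + 1) → K) : MvPolynomial (Fin (n + 1)) K →ₐ[K] MvPolynomial (Fin n) K :=
  aeval (Fin.snoc (α := fun _ => MvPolynomial (Fin n) K) X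
    (-linearForm fun i => c i.castSucc / c (Fin.last n)))

/-- The effect of `restrictTo` on coefficients of linear forms. -/
def restrictCoeff (c : Fin (n + 1) → K) : (Fin (n + 1) → K) →ₗ[K] (Fin n → K) :=
  LinearMap.pi fun i => LinearMap.proj i.castSucc -
    (c i.castSucc / c (Fin.last n)) • LinearMap.proj (Fin.last n)

lemma restrictCoeff_surjective (c : Fin (n + 1) → K) : Function.Surjective (restrictCoeff c) := by
  intro b
  refine ⟨Fin.snoc (α := fun _ => K) b 0, ?_⟩
  ext i
  simp [restrictCoeff]

@[simp] lemma restrictTo_X_castSucc (c : Fin (n + 1) → K) (i : Fin n) :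
    restrictTo c (X i.castSucc) = X i := by
  simp [restrictTo]

@[simp] lemma restrictTo_X_last (c : Fin (n + 1) → K) :
    restrictTo c (X (Fin.last n)) = -linearForm fun i => c i.castSucc / c (Fin.last n) := by
  simp [restrictTo]

lemma restrictTo_linearForm (c a : Fin (n + 1) → K) :
    restrictTo c (linearForm a) = linearForm (restrictCoeff c a) := by
  rw [linearForm, Fin.sum_univ_castSucc]
  simp only [map_add, map_sum, map_mul, restrictTo_X_castSucc, restrictTo_X_last]
  simp only [linearForm, restrictCoeff, algHom_C, algebraMap_eq, LinearMap.pi_apply,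
    LinearMap.sub_apply, LinearMap.smul_apply, LinearMap.proj_apply, map_sub, sub_mul,
    Finset.sum_sub_distrib, mul_neg, Finset.mul_sum, smul_eq_mul, map_mul, ← sub_eq_add_neg]
  refine congrArg (fun s => _ - s) (Finset.sum_congr rfl fun i _ => ?_)
  ring

lemma restrictTo_linearForm_self {c : Fin (n + 1) → K} (hc : c (Fin.last n) ≠ 0) :
    restrictTo c (linearForm c) = 0 := by
  have : restrictCoeff c c = 0 := by
    ext i
    simp [restrictCoeff, div_mul_cancel₀ _ hc]
  rw [restrictTo_linearForm, this]
  simp [linearForm]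

lemma restrictTo_rename (c : Fin (n + 1) → K) (f : MvPolynomial (Fin n) K) :
    restrictTo c (rename Fin.castSucc f) = f := by
  rw [restrictTo, aeval_rename]
  convert aeval_X_left_apply f using 3
  ext i
  simp

/-- Restricting and then including the smaller polynomial ring is the identity modulo the linear
form, as one checks on variables. -/
lemma linearForm_dvd_of_restrictTo_eq_zero {c : Fin (n + 1) → K} (hc : c (Fin.last n) ≠ 0)
    {f : MvPolynomial (Fin (n + 1)) K} (hf : restrictTo c f = 0) : linearForm c ∣ f := by
  let I : Ideal (MvPolynomial (Fin (n + 1)) K) := Ideal.span {linearForm c}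
  have key : ((Ideal.Quotient.mkₐ K I).comp (rename Fin.castSucc)).comp (restrictTo c) =
      Ideal.Quotient.mkₐ K I := by
    apply MvPolynomial.algHom_ext
    intro i
    refine Fin.lastCases ?_ (fun i => ?_) i
    · simp only [AlgHom.comp_apply, restrictTo_X_last, Ideal.Quotient.mkₐ_eq_mk]
      rw [Ideal.Quotient.eq, Ideal.mem_span_singleton]
      refine ⟨-C (c (Fin.last n))⁻¹, ?_⟩
      conv_rhs => rw [linearForm, Fin.sum_univ_castSucc]
      simp only [linearForm, map_neg, map_sum, map_mul, rename_C, rename_X, div_eq_mul_inv]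
      rw [mul_neg, add_mul, neg_add, Finset.sum_mul]
      have : C (c (Fin.last n)) * X (Fin.last n) * C (c (Fin.last n))⁻¹ =
          (X (Fin.last n) : MvPolynomial (Fin (n + 1)) K) := by
        rw [mul_right_comm, ← C_mul, mul_inv_cancel₀ hc, C_1, one_mul]
      rw [this, sub_eq_add_neg]
      refine congrArg (fun s => -s + -X (Fin.last n)) (Finset.sum_congr rfl fun j _ => ?_)
      ring
    · simp
  have := AlgHom.congr_fun key f
  rw [AlgHom.comp_apply, hf, map_zero] at this
  exact Ideal.mem_span_singleton.1 (Ideal.Quotient.eq_zero_iff_mem.1 this.symm)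

lemma restrictTo_isHomogeneous (c : Fin (n + 1) → K) {f : MvPolynomial (Fin (n + 1)) K} {d : ℕ}
    (hf : f.IsHomogeneous d) : (restrictTo c f).IsHomogeneous d := by
  have := hf.aeval (n := 1) (Fin.snoc (α := fun _ => MvPolynomial (Fin n) K) X
    (-linearForm fun i => c i.castSucc / c (Fin.last n))) (fun i => by
      refine Fin.lastCases ?_ (fun i => ?_) i
      · simpa using (isHomogeneous_linearForm _).neg
      · simpa using isHomogeneous_X K i)
  rwa [one_mul] at this

lemma map_restrictTo_le (c : Fin (n + 1) → K) {d : ℕ}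
    {V : Submodule K (MvPolynomial (Fin (n + 1)) K)}
    (hV : V ≤ homogeneousSubmodule (Fin (n + 1)) K d) :
    V.map (restrictTo c).toLinearMap ≤ homogeneousSubmodule (Fin n) K d := by
  rintro _ ⟨f, hf, rfl⟩
  exact restrictTo_isHomogeneous c (hV hf)

lemma map_restrictTo_homogeneousSubmodule (c : Fin (n + 1) → K) (d : ℕ) :
    (homogeneousSubmodule (Fin (n + 1)) K d).map (restrictTo c).toLinearMap =
      homogeneousSubmodule (Fin n) K d := by
  refine le_antisymm (map_restrictTo_le c le_rfl) fun f hf => ?_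
  exact ⟨rename Fin.castSucc f, IsHomogeneous.rename_isHomogeneous hf, restrictTo_rename c f⟩

lemma finrank_map_add_finrank_inf_ker {V W : Type*} [AddCommGroup V] [Module K V]
    [AddCommGroup W] [Module K W] (f : V →ₗ[K] W) (S : Submodule K V) [FiniteDimensional K S] :
    Module.finrank K (S.map f) + Module.finrank K (S ⊓ LinearMap.ker f : Submodule K V) =
      Module.finrank K S := by
  have h := LinearMap.finrank_range_add_finrank_ker (f.domRestrict S)
  rw [LinearMap.range_domRestrict, LinearMap.ker_domRestrict] at h
  rw [← h, ← Submodule.map_comap_subtype, Submodule.finrank_map_subtype_eq]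

/-- The exact sequence 0 → (V : ℓ) → V → V|_{ℓ=0} → 0, whose first map is multiplication by ℓ. -/
lemma finrank_map_restrictTo_add {d : ℕ} {c : Fin (n + 1) → K} (hc : c (Fin.last n) ≠ 0)
    {V : Submodule K (MvPolynomial (Fin (n + 1)) K)}
    (hV : V ≤ homogeneousSubmodule (Fin (n + 1)) K d) :
    Module.finrank K (V.map (restrictTo c).toLinearMap) +
      Module.finrank K (colonBy V (linearForm c)) = Module.finrank K V := by
  have := finiteDimensional_of_le_homogeneous hV
  rw [← finrank_map_add_finrank_inf_ker (restrictTo c).toLinearMap V]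
  congr 1
  have : V ⊓ LinearMap.ker (restrictTo c).toLinearMap =
      (colonBy V (linearForm c)).map (LinearMap.mulLeft K (linearForm c)) := by
    ext f
    simp only [Submodule.mem_inf, LinearMap.mem_ker, Submodule.mem_map, mem_colonBy,
      LinearMap.mulLeft_apply, AlgHom.toLinearMap_apply]
    constructor
    · rintro ⟨hf, h0⟩
      obtain ⟨w, rfl⟩ := linearForm_dvd_of_restrictTo_eq_zero hc h0
      exact ⟨w, hf, rfl⟩
    · rintro ⟨w, hw, rfl⟩
      exact ⟨hw, by rw [map_mul, restrictTo_linearForm_self hc, zero_mul]⟩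
  rw [this]
  exact (Submodule.equivMapOfInjective _
    (fun _ _ h => mul_left_cancel₀ (linearForm_ne_zero hc) h) _).finrank_eq

end Restriction

/-! ### Dimensions of spaces spanned by monomials -/

section Monomials

variable {n : ℕ}

/-- Regard a monomial in `n` variables as one in countably many variables. -/
def extendExp (n : ℕ) (a : Fin n →₀ ℕ) : ℕ →₀ ℕ := a.embDomain Fin.valEmbedding

lemma extendExp_injective : Function.Injective (extendExp n) :=
  Finsupp.embDomain_injective _

lemma extendExp_apply_val (a : Fin n →₀ ℕ) (i : Fin n) : extendExp n a i = a i :=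
  Finsupp.embDomain_apply_self Fin.valEmbedding a i

lemma extendExp_apply_of_le (a : Fin n →₀ ℕ) {i : ℕ} (hi : n ≤ i) : extendExp n a i = 0 := by
  apply Finsupp.embDomain_of_notMem_range
  rintro ⟨j, rfl⟩
  exact absurd j.2 (not_lt.2 hi)

lemma degree_extendExp (a : Fin n →₀ ℕ) : (extendExp n a).degree = a.degree := by
  rw [Finsupp.degree_apply, Finsupp.degree_apply, extendExp, Finsupp.support_embDomain,
    Finset.sum_map]
  exact Finset.sum_congr rfl fun i _ => Finsupp.embDomain_apply_self _ a i

lemma extendExp_add_single (a : Fin n →₀ ℕ) (i : Fin n) :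
    extendExp n (a + Finsupp.single i 1) = extendExp n a + Finsupp.single (i : ℕ) 1 := by
  simp [extendExp, Finsupp.embDomain_add, Finsupp.embDomain_single]

lemma extendExp_mem_monomialsOf {d : ℕ} {a : Fin n →₀ ℕ} :
    extendExp n a ∈ monomialsOf n d ↔ a.degree = d := by
  rw [mem_monomialsOf, degree_extendExp]
  exact and_iff_right fun i hi => extendExp_apply_of_le a hi

lemma exists_extendExp_eq {d : ℕ} {b : ℕ →₀ ℕ} (hb : b ∈ monomialsOf n d) :
    ∃ a : Fin n →₀ ℕ, a.degree = d ∧ extendExp n a = b := by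
  have : extendExp n (Finsupp.equivFunOnFinite.symm fun i : Fin n => b i) = b := by
    ext i
    by_cases hi : i < n
    · exact extendExp_apply_val _ ⟨i, hi⟩
    · rw [extendExp_apply_of_le _ (not_lt.1 hi), (mem_monomialsOf.1 hb).1 i (not_lt.1 hi)]
  exact ⟨_, extendExp_mem_monomialsOf.1 (this.symm ▸ hb : extendExp n _ ∈ _), this⟩

lemma toLex_extendExp_lt {a b : Fin n →₀ ℕ} :
    toLex (extendExp n a) < toLex (extendExp n b) ↔ toLex a < toLex b := by
  rw [toLex_lt_iff, toLex_lt_iff]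
  constructor
  · rintro ⟨i, hi, hi'⟩
    by_cases hin : i < n
    · refine ⟨⟨i, hin⟩, fun j hj => ?_, ?_⟩
      · rw [← extendExp_apply_val, ← extendExp_apply_val, hi j hj]
      · rwa [← extendExp_apply_val, ← extendExp_apply_val]
    · rw [extendExp_apply_of_le a (not_lt.1 hin), extendExp_apply_of_le b (not_lt.1 hin)] at hi'
      exact absurd hi' (lt_irrefl _)
  · rintro ⟨i, hi, hi'⟩
    refine ⟨i, fun j hj => ?_, ?_⟩
    · have := hi ⟨j, hj.trans i.2⟩ hj
      rwa [← extendExp_apply_val, ← extendExp_apply_val] at this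
    · rwa [extendExp_apply_val, extendExp_apply_val]

/-- The exponents in `n` variables that correspond to elements of `U`. -/
def restrictExp (n : ℕ) (U : Finset (ℕ →₀ ℕ)) : Set (Fin n →₀ ℕ) := extendExp n ⁻¹' U

lemma mem_restrictExp {U : Finset (ℕ →₀ ℕ)} {a : Fin n →₀ ℕ} :
    a ∈ restrictExp n U ↔ extendExp n a ∈ U := Iff.rfl

lemma image_restrictExp {d : ℕ} {U : Finset (ℕ →₀ ℕ)} (hU : U ⊆ monomialsOf n d) :
    extendExp n '' restrictExp n U = U := by
  rw [restrictExp, Set.image_preimage_eq_iff]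
  intro b hb
  obtain ⟨a, -, rfl⟩ := exists_extendExp_eq (hU hb)
  exact ⟨a, rfl⟩

lemma ncard_restrictExp {d : ℕ} {U : Finset (ℕ →₀ ℕ)} (hU : U ⊆ monomialsOf n d) :
    (restrictExp n U).ncard = U.card := by
  rw [← Set.ncard_image_of_injective _ extendExp_injective, image_restrictExp hU,
    Set.ncard_coe_finset]

lemma restrictExp_monomialsOf (n d : ℕ) :
    restrictExp n (monomialsOf n d) = {a : Fin n →₀ ℕ | a.degree = d} := by
  ext a
  exact extendExp_mem_monomialsOf

/-- Links exponents on `Fin n` to exponents on `ℕ`, where a change in the number of variables does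
not change the type. -/
lemma lexSegment_eq (n d m : ℕ) : lexSegment n d m = restrictExp n (lexSeg n d m) := by
  ext a
  rw [mem_restrictExp, lexSeg, mem_topPart, extendExp_mem_monomialsOf, lexSegment, Set.mem_ofPred_eq]
  refine and_congr_right fun _ => ?_
  have : {b : Fin n →₀ ℕ | b.degree = d ∧ toLex a < toLex b} = restrictExp n
      ((monomialsOf n d).filter fun b => toLex (extendExp n a) < toLex b) := by
    ext b
    rw [mem_restrictExp, Finset.mem_filter, extendExp_mem_monomialsOf, toLex_extendExp_lt,
      Set.mem_ofPred_eq]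
  rw [this, ncard_restrictExp (Finset.filter_subset _ _), numAbove]

variable (K : Type*) [Field K]

lemma finrank_restrictSupport (S : Set (Fin n →₀ ℕ)) :
    Module.finrank K (restrictSupport K S) = S.ncard :=
  Module.finrank_eq_nat_card_basis (basisRestrictSupport K S)

lemma homogeneousSubmodule_eq_restrictSupport (n d : ℕ) :
    homogeneousSubmodule (Fin n) K d = restrictSupport K (restrictExp n (monomialsOf n d)) := by
  rw [restrictExp_monomialsOf]
  exact homogeneousSubmodule_eq_finsupp_supported _ _ _

lemma finrank_homogeneousSubmodule (n d : ℕ) :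
    Module.finrank K (homogeneousSubmodule (Fin n) K d) = (monomialsOf n d).card := by
  rw [homogeneousSubmodule_eq_restrictSupport, finrank_restrictSupport,
    ncard_restrictExp Finset.Subset.rfl]

lemma lexSpace_eq (n d m : ℕ) :
    lexSpace K n d m = restrictSupport K (restrictExp n (lexSeg n d m)) := by
  rw [lexSpace, lexSegment_eq, restrictSupport_eq_span]

lemma homogeneousSubmodule_one_mul_lexSpace (n d m : ℕ) :
    homogeneousSubmodule (Fin n) K 1 * lexSpace K n d m =
      restrictSupport K (restrictExp n (shadowOf n (lexSeg n d m))) := by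
  rw [homogeneousSubmodule_eq_restrictSupport, lexSpace_eq, ← restrictSupport_add]
  congr 1
  ext b
  rw [Set.mem_add, mem_restrictExp, mem_shadowOf]
  constructor
  · rintro ⟨x, hx, a, ha, rfl⟩
    rw [restrictExp_monomialsOf, ← Finsupp.range_single_one] at hx
    obtain ⟨i, rfl⟩ := hx
    exact ⟨_, ha, i, i.2, by
      rw [← extendExp_add_single, add_comm]⟩
  · rintro ⟨a, ha, i, hi, h⟩
    obtain ⟨a, -, rfl⟩ := exists_extendExp_eq (topPart_subset _ ha)
    have := extendExp_add_single a ⟨i, hi⟩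
    refine ⟨Finsupp.single ⟨i, hi⟩ 1, ?_, a, ha, ?_⟩
    · rw [mem_restrictExp, extendExp_mem_monomialsOf, Finsupp.degree_single]
    · rw [add_comm]
      exact extendExp_injective (this.trans h)

lemma finrank_homogeneousSubmodule_one_mul_lexSpace (n d m : ℕ) :
    Module.finrank K (homogeneousSubmodule (Fin n) K 1 * lexSpace K n d m :
      Submodule K (MvPolynomial (Fin n) K)) = lexGrowth n d m := by
  rw [homogeneousSubmodule_one_mul_lexSpace, finrank_restrictSupport,
    ncard_restrictExp (shadowOf_subset (isLexSeg_lexSeg n d m).1), lexGrowth]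

variable {K}

lemma finrank_le_card_monomialsOf {d : ℕ} {V : Submodule K (MvPolynomial (Fin n) K)}
    (hV : V ≤ homogeneousSubmodule (Fin n) K d) :
    Module.finrank K V ≤ (monomialsOf n d).card := by
  rw [← finrank_homogeneousSubmodule K]
  exact Submodule.finrank_mono hV

end Monomials

lemma monomialsOf_zero_succ (d : ℕ) : monomialsOf 0 (d + 1) = ∅ := by
  simp [monomialsOf]

lemma numWithoutLast_zero_succ (d m : ℕ) : numWithoutLast 0 (d + 1) m = 0 := by
  have := (isLexSeg_lexSeg 1 (d + 1) m).filter_last.1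
  rw [monomialsOf_zero_succ, Finset.subset_empty] at this
  rw [numWithoutLast, this, Finset.card_empty]

lemma numWithLast_degree_zero (n m : ℕ) : numWithLast n 0 m = 0 := by
  rw [numWithLast, Finset.card_eq_zero, Finset.filter_eq_empty_iff]
  intro a ha
  have := topPart_subset _ ha
  simp only [monomialsOf, Finset.finsuppAntidiag_zero, Finset.mem_singleton] at this
  simp [this]

/-! ### Green's hyperplane restriction theorem and Macaulay's theorem -/

section Green

variable {K : Type*} [Field K]

lemma exists_minimal_finrank_colonBy {n : ℕ} (V : Submodule K (MvPolynomial (Fin (n + 1)) K)) :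
    ∃ h : Fin (n + 1) → K, h (Fin.last n) ≠ 0 ∧ ∀ c : Fin (n + 1) → K, c (Fin.last n) ≠ 0 →
      Module.finrank K (colonBy V (linearForm h)) ≤ Module.finrank K (colonBy V (linearForm c)) := by
  let S : Set ℕ := {k | ∃ c : Fin (n + 1) → K, c (Fin.last n) ≠ 0 ∧
    Module.finrank K (colonBy V (linearForm c)) = k}
  have hS : S.Nonempty := ⟨_, 1, one_ne_zero, rfl⟩
  obtain ⟨h, hh, he⟩ := Nat.sInf_mem hS
  exact ⟨h, hh, fun c hc => he ▸ Nat.sInf_le ⟨c, hc, rfl⟩⟩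

lemma map_mul_restrictTo {n : ℕ} (c : Fin (n + 1) → K)
    (V : Submodule K (MvPolynomial (Fin (n + 1)) K)) :
    (homogeneousSubmodule (Fin (n + 1)) K 1 * V).map (restrictTo c).toLinearMap =
      homogeneousSubmodule (Fin n) K 1 * V.map (restrictTo c).toLinearMap := by
  rw [Submodule.map_mul, map_restrictTo_homogeneousSubmodule]

lemma homogeneousSubmodule_one_mul_le {n d : ℕ} {V : Submodule K (MvPolynomial (Fin n) K)}
    (hV : V ≤ homogeneousSubmodule (Fin n) K d) :
    homogeneousSubmodule (Fin n) K 1 * V ≤ homogeneousSubmodule (Fin n) K (d + 1) := by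
  rw [add_comm]
  exact (mul_le_mul_right hV _).trans (homogeneousSubmodule_mul 1 d)

/-- Restrict R_1 V to the hyperplane ℓ = 0: the image is R_1 times the restriction of V, and (R_1 V
: ℓ) contains V. -/
lemma finrank_add_finrank_mul_map_le {n d : ℕ} {c : Fin (n + 1) → K} (hc : c (Fin.last n) ≠ 0)
    {V : Submodule K (MvPolynomial (Fin (n + 1)) K)}
    (hV : V ≤ homogeneousSubmodule (Fin (n + 1)) K d) :
    Module.finrank K V + Module.finrank K (homogeneousSubmodule (Fin n) K 1 *
        V.map (restrictTo c).toLinearMap : Submodule K (MvPolynomial (Fin n) K)) ≤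
      Module.finrank K (homogeneousSubmodule (Fin (n + 1)) K 1 * V :
        Submodule K (MvPolynomial (Fin (n + 1)) K)) := by
  have hRV := homogeneousSubmodule_one_mul_le hV
  rw [← finrank_map_restrictTo_add hc hRV, map_mul_restrictTo, add_comm]
  refine Nat.add_le_add_left ?_ _
  have := finiteDimensional_of_le_homogeneous
    (colonBy_le hRV (isHomogeneous_linearForm c) (linearForm_ne_zero hc))
  exact Submodule.finrank_mono fun w hw => Submodule.mul_mem_mul (isHomogeneous_linearForm c) hw

variable [Infinite K]

/-- The inductive step for Green's theorem, using it for spaces of forms in fewer variables or of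
smaller degree. -/
lemma eventually_colonBy_aux {n : ℕ}
    (ih : ∀ k, k + 1 = n → ∀ d (V : Submodule K (MvPolynomial (Fin (k + 1)) K)),
      V ≤ homogeneousSubmodule (Fin (k + 1)) K d →
      ∀ᶠ c in genericFilter K (k + 1), Module.finrank K (colonBy V (linearForm c)) ≤
        numWithLast k d (Module.finrank K V))
    (d : ℕ) {V : Submodule K (MvPolynomial (Fin (n + 1)) K)}
    (hV : V ≤ homogeneousSubmodule (Fin (n + 1)) K d) :
    ∀ᶠ c in genericFilter K (n + 1), Module.finrank K (colonBy V (linearForm c)) ≤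
      numWithLast n d (Module.finrank K V) := by
  induction d generalizing V with
  | zero =>
    filter_upwards [eventually_generic_last_ne_zero K n] with c hc
    rw [colonBy_eq_bot hV (isHomogeneous_linearForm c) (linearForm_ne_zero hc), finrank_bot]
    exact Nat.zero_le _
  | succ d ihd =>
    -- Generic colon dimensions do not exceed the one at `h`, so it is enough to bound the minimal
    -- one.
    obtain ⟨h, hh, hmin⟩ := exists_minimal_finrank_colonBy V
    have hgen := eventually_finrank_colonBy_le hV hh
    suffices Module.finrank K (colonBy V (linearForm h)) ≤
        numWithLast n (d + 1) (Module.finrank K V) by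
      filter_upwards [hgen] with c hc using hc.trans this
    by_contra! hlt
    have hrn := finrank_map_restrictTo_add hh hV
    have hmN := finrank_le_card_monomialsOf hV
    have hsum := numWithoutLast_add_numWithLast hmN
    -- In a single variable every monomial of positive degree is divisible by it, so the bound is
    -- dim V itself.
    rcases n with _ | n
    · rw [numWithoutLast_zero_succ] at hsum
      lia
    have hcol := colonBy_le hV (isHomogeneous_linearForm h) (linearForm_ne_zero hh)
    have hres := map_restrictTo_le h hV
    set m := Module.finrank K V
    set r := Module.finrank K (V.map (restrictTo h).toLinearMap) with hr
    set κ := Module.finrank K (colonBy V (linearForm h)) with hκ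
    have hκN : κ ≤ (monomialsOf (n + 2) d).card := finrank_le_card_monomialsOf hcol
    have hnum := numWithLast_lt_numWithoutLast (r := r) hmN (by lia)
      (by rwa [show m - r = κ by lia])
    rw [show m - r = κ by lia] at hnum
    have hsumκ := numWithoutLast_add_numWithLast hκN
    have htend := tendsto_genericFilter (restrictCoeff h) (restrictCoeff_surjective h)
    -- One `g` is generic both for (V : h), by induction on the degree, and, after restriction to h
    -- = 0, for the restriction of V, by induction on the number of variables.
    obtain ⟨g, hg, hgκ, hgcol, hgres, hg'⟩ := ((eventually_generic_last_ne_zero K (n + 1)).and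
      (hgen.and ((ihd hcol).and ((htend.eventually (ih n rfl _ _ hres)).and
        (htend.eventually (eventually_generic_last_ne_zero K n)))))).exists
    rw [← hκ] at hgcol
    rw [← hr] at hgres
    have hle : (colonBy V (linearForm g)).map (restrictTo h).toLinearMap ≤
        colonBy (V.map (restrictTo h).toLinearMap) (linearForm (restrictCoeff h g)) := by
      rintro _ ⟨w, hw, rfl⟩
      refine ⟨linearForm g * w, hw, ?_⟩
      rw [AlgHom.toLinearMap_apply, map_mul, restrictTo_linearForm]
      rfl
    have := finiteDimensional_of_le_homogeneous
      (colonBy_le hres (isHomogeneous_linearForm _) (linearForm_ne_zero hg'))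
    have h1 := Submodule.finrank_mono hle
    -- By minimality dim (V : g) ≥ κ, and ((V : g) : h) = ((V : h) : g) has dimension at most
    -- `numWithLast (n + 1) d κ`. So (V : g) restricts to a space of dimension at least
    -- `numWithoutLast (n + 1) d κ`, while `hle` and `hgres` bound it by `numWithLast n (d + 1) r`,
    -- against `hnum`.
    have h2 := finrank_map_restrictTo_add hh
      (colonBy_le hV (isHomogeneous_linearForm g) (linearForm_ne_zero hg))
    rw [colonBy_comm] at h2
    have h3 := hmin g hg
    omega

/-- **Green's hyperplane restriction theorem**: for a generic linear form the colon space of a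
space of forms is at most as large as for the lex segment of the same dimension. -/
theorem eventually_finrank_colonBy_le_numWithLast (n d : ℕ)
    {V : Submodule K (MvPolynomial (Fin (n + 1)) K)}
    (hV : V ≤ homogeneousSubmodule (Fin (n + 1)) K d) :
    ∀ᶠ c in genericFilter K (n + 1), Module.finrank K (colonBy V (linearForm c)) ≤
      numWithLast n d (Module.finrank K V) := by
  induction n generalizing d with
  | zero => exact eventually_colonBy_aux (fun _ h => absurd h (by lia)) d hV
  | succ n ihn =>
    refine eventually_colonBy_aux (fun k hk e W hW => ?_) d hV
    obtain rfl : k = n := by lia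
    exact ihn e hW

lemma eventually_numWithoutLast_le (n d : ℕ) {V : Submodule K (MvPolynomial (Fin (n + 1)) K)}
    (hV : V ≤ homogeneousSubmodule (Fin (n + 1)) K d) :
    ∀ᶠ c in genericFilter K (n + 1), numWithoutLast n d (Module.finrank K V) ≤
      Module.finrank K (V.map (restrictTo c).toLinearMap) := by
  filter_upwards [eventually_generic_last_ne_zero K n,
    eventually_finrank_colonBy_le_numWithLast n d hV] with c hc hc'
  have h1 := finrank_map_restrictTo_add hc hV
  have h2 := numWithoutLast_add_numWithLast (finrank_le_card_monomialsOf hV)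
  lia

/-- **Macaulay's theorem**: among the spaces of forms of a given dimension, lex segments have the
smallest growth. -/
theorem lexGrowth_le_finrank_mul (n d : ℕ) {V : Submodule K (MvPolynomial (Fin n) K)}
    (hV : V ≤ homogeneousSubmodule (Fin n) K d) :
    lexGrowth n d (Module.finrank K V) ≤ Module.finrank K (homogeneousSubmodule (Fin n) K 1 * V :
      Submodule K (MvPolynomial (Fin n) K)) := by
  induction n with
  | zero => simp [lexGrowth, shadowOf]
  | succ n ih =>
    -- By Green's theorem the restriction of V to some hyperplane has at least the dimension of its
    -- lex counterpart.
    obtain ⟨c, hc, hc'⟩ := ((eventually_generic_last_ne_zero K n).and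
      (eventually_numWithoutLast_le n d hV)).exists
    rw [lexGrowth_succ (finrank_le_card_monomialsOf hV)]
    exact (Nat.add_le_add_left ((lexGrowth_mono hc').trans (ih (map_restrictTo_le c hV))) _).trans
      (finrank_add_finrank_mul_map_le hc hV)

/-- A space of forms of minimal growth also attains the bound in Green's theorem. -/
theorem eventually_numWithLast_le_finrank_colonBy (n d : ℕ)
    {V : Submodule K (MvPolynomial (Fin (n + 1)) K)}
    (hV : V ≤ homogeneousSubmodule (Fin (n + 1)) K d)
    (hgrowth : Module.finrank K (homogeneousSubmodule (Fin (n + 1)) K 1 * V :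
      Submodule K (MvPolynomial (Fin (n + 1)) K)) = lexGrowth (n + 1) d (Module.finrank K V)) :
    ∀ᶠ c in genericFilter K (n + 1), numWithLast n d (Module.finrank K V) ≤
      Module.finrank K (colonBy V (linearForm c)) := by
  -- Degree zero is set apart because strict monotonicity of `lexGrowth` fails for the constant
  -- monomial in zero variables.
  rcases d with _ | d
  · simp [numWithLast_degree_zero]
  filter_upwards [eventually_generic_last_ne_zero K n] with c hc
  have hres := map_restrictTo_le c hV
  have h1 := finrank_map_restrictTo_add hc hV
  have h2 := numWithoutLast_add_numWithLast (finrank_le_card_monomialsOf hV)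
  have h3 := finrank_le_card_monomialsOf hres
  -- A colon space that is too small makes the restriction too large; Macaulay's theorem there and
  -- strict monotonicity of `lexGrowth` then make V grow too fast.
  by_contra! hlt
  rcases n with _ | n
  · rw [monomialsOf_zero_succ, Finset.card_empty] at h3
    lia
  have h4 := lexGrowth_lt (d := d + 1) (show numWithoutLast (n + 1) (d + 1) (Module.finrank K V) <
    Module.finrank K (V.map (restrictTo c).toLinearMap) by lia) h3
  have h5 := lexGrowth_le_finrank_mul (n + 1) (d + 1) hres
  have h6 := finrank_add_finrank_mul_map_le hc hV
  rw [hgrowth, lexGrowth_succ (finrank_le_card_monomialsOf hV)] at h6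
  lia

end Green

/-! ### Hilbert functions and the rank of multiplication by a linear form -/

section Quotient

variable {K : Type*} [Field K] {n : ℕ}

lemma mem_idealPiece {I : Ideal (MvPolynomial (Fin n) K)} {d : ℕ} {f : MvPolynomial (Fin n) K} :
    f ∈ idealPiece I d ↔ f.IsHomogeneous d ∧ f ∈ I := Iff.rfl

lemma idealPiece_le (I : Ideal (MvPolynomial (Fin n) K)) (d : ℕ) :
    idealPiece I d ≤ homogeneousSubmodule (Fin n) K d := inf_le_left

instance finiteDimensional_quotientPiece (I : Ideal (MvPolynomial (Fin n) K)) (d : ℕ) :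
    FiniteDimensional K (quotientPiece I d) := by
  rw [quotientPiece]
  infer_instance

lemma hilbertFunction_add_finrank_idealPiece (I : Ideal (MvPolynomial (Fin n) K)) (d : ℕ) :
    hilbertFunction I d + Module.finrank K (idealPiece I d) = (monomialsOf n d).card := by
  rw [← finrank_homogeneousSubmodule K, ← finrank_map_add_finrank_inf_ker
    (Ideal.Quotient.mkₐ K I).toLinearMap (homogeneousSubmodule (Fin n) K d), hilbertFunction,
    quotientPiece]
  have : idealPiece I d = homogeneousSubmodule (Fin n) K d ⊓
      LinearMap.ker (Ideal.Quotient.mkₐ K I).toLinearMap := by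
    ext f
    rw [mem_idealPiece, Submodule.mem_inf, LinearMap.mem_ker]
    exact and_congr_right fun _ => Ideal.Quotient.eq_zero_iff_mem.symm
  rw [this]

lemma hilbertFunction_eq_zero_iff {I : Ideal (MvPolynomial (Fin n) K)} {d : ℕ} :
    hilbertFunction I d = 0 ↔ ∀ f : MvPolynomial (Fin n) K, f.IsHomogeneous d → f ∈ I := by
  rw [hilbertFunction, Submodule.finrank_eq_zero, quotientPiece, ← le_bot_iff,
    Submodule.map_le_iff_le_comap]
  exact ⟨fun h f hf => Ideal.Quotient.eq_zero_iff_mem.1 (h hf),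
    fun h f hf => Ideal.Quotient.eq_zero_iff_mem.2 (h f hf)⟩

lemma hilbertFunction_zero_eq_zero_iff {I : Ideal (MvPolynomial (Fin n) K)} :
    hilbertFunction I 0 = 0 ↔ I = ⊤ := by
  rw [hilbertFunction_eq_zero_iff]
  constructor
  · intro h
    exact (Ideal.eq_top_iff_one _).2 (h 1 (isHomogeneous_one _ _))
  · rintro rfl f -
    trivial

lemma map_mulLeft_quotientPiece_le (I : Ideal (MvPolynomial (Fin n) K)) (c : Fin n → K) (d : ℕ) :
    (quotientPiece I d).map (LinearMap.mulLeft K (Ideal.Quotient.mk I (linearForm c))) ≤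
      quotientPiece I (d + 1) := by
  rintro _ ⟨_, ⟨w, hw, rfl⟩, rfl⟩
  refine ⟨linearForm c * w, ?_, map_mul (Ideal.Quotient.mk I) _ _⟩
  rw [add_comm]
  exact (isHomogeneous_linearForm c).mul hw

/-- The rank of multiplication by a linear form never exceeds the maximal rank. -/
lemma finrank_map_mulLeft_le (I : Ideal (MvPolynomial (Fin n) K)) (c : Fin n → K) (d : ℕ) :
    Module.finrank K ((quotientPiece I d).map
        (LinearMap.mulLeft K (Ideal.Quotient.mk I (linearForm c)))) ≤
      min (hilbertFunction I d) (hilbertFunction I (d + 1)) :=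
  le_min (Submodule.finrank_map_le _ _)
    (Submodule.finrank_mono (map_mulLeft_quotientPiece_le I c d))

/-- Rank and nullity of R_d → A, w ↦ ℓw: the image is ℓA_d and the kernel is (I_{d+1} : ℓ). -/
lemma finrank_map_mulLeft_add (I : Ideal (MvPolynomial (Fin n) K)) {c : Fin n → K}
    (hc : linearForm c ≠ 0) (d : ℕ) :
    Module.finrank K ((quotientPiece I d).map
        (LinearMap.mulLeft K (Ideal.Quotient.mk I (linearForm c)))) +
      Module.finrank K (colonBy (idealPiece I (d + 1)) (linearForm c)) =
        (monomialsOf n d).card := by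
  rw [← finrank_homogeneousSubmodule K, ← finrank_map_add_finrank_inf_ker
    ((Ideal.Quotient.mkₐ K I).toLinearMap ∘ₗ LinearMap.mulLeft K (linearForm c))
    (homogeneousSubmodule (Fin n) K d)]
  have h1 : (quotientPiece I d).map
      (LinearMap.mulLeft K (Ideal.Quotient.mk I (linearForm c))) =
      (homogeneousSubmodule (Fin n) K d).map
        ((Ideal.Quotient.mkₐ K I).toLinearMap ∘ₗ LinearMap.mulLeft K (linearForm c)) := by
    rw [quotientPiece, ← Submodule.map_comp]
    congr 1
  have h2 : colonBy (idealPiece I (d + 1)) (linearForm c) = homogeneousSubmodule (Fin n) K d ⊓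
      LinearMap.ker
        ((Ideal.Quotient.mkₐ K I).toLinearMap ∘ₗ LinearMap.mulLeft K (linearForm c)) := by
    ext w
    rw [Submodule.mem_inf, LinearMap.mem_ker]
    constructor
    · intro hw
      exact ⟨colonBy_le (idealPiece_le I (d + 1)) (isHomogeneous_linearForm c) hc hw,
        Ideal.Quotient.eq_zero_iff_mem.2 hw.2⟩
    · rintro ⟨hw, h0⟩
      refine ⟨?_, Ideal.Quotient.eq_zero_iff_mem.1 h0⟩
      rw [add_comm]
      exact (isHomogeneous_linearForm c).mul hw
  rw [h1, h2]

/-- The powers of the ideal of the variables stabilise in A. Hence a form of large degree d is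
congruent modulo I to a polynomial with all terms of degree above d, and taking degree d components
puts the form in I. -/
lemma exists_forall_le_hilbertFunction_eq_zero {I : Ideal (MvPolynomial (Fin n) K)}
    (hI : DefinesArtinianAlgebra I) : ∃ D, ∀ d, D ≤ d → hilbertFunction I d = 0 := by
  obtain ⟨hhom, -, hart⟩ := hI
  let M := idealOfVars (Fin n) K
  let F : ℕ →o (Ideal (MvPolynomial (Fin n) K ⧸ I))ᵒᵈ :=
    ⟨fun d => OrderDual.toDual ((M ^ d).map (Ideal.Quotient.mk I)),
      fun _ _ h => Ideal.map_mono (Ideal.pow_le_pow_right h)⟩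
  obtain ⟨D, hD⟩ := IsArtinian.monotone_stabilizes F
  refine ⟨D, fun d hd => hilbertFunction_eq_zero_iff.2 fun f hf => ?_⟩
  have heq : (M ^ d).map (Ideal.Quotient.mk I) = (M ^ (d + 1)).map (Ideal.Quotient.mk I) :=
    (hD d hd).symm.trans (hD (d + 1) (by lia))
  have hfM : f ∈ M ^ d := by
    rw [mem_pow_idealOfVars_iff]
    intro a ha
    exact (hf.degree_eq_sum_deg_support ha).le
  have hmem := Ideal.mem_map_of_mem (Ideal.Quotient.mk I) hfM
  rw [heq, Ideal.mem_map_iff_of_surjective _ Ideal.Quotient.mk_surjective] at hmem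
  obtain ⟨g, hg, hgf⟩ := hmem
  have hfg := homogeneousComponent_mem_of_mem hhom (Ideal.Quotient.eq.1 hgf) d
  rw [map_sub, homogeneousComponent_of_mem (m := d) hf, if_pos rfl] at hfg
  have hg0 : homogeneousComponent d g = 0 := by
    ext a
    rw [coeff_homogeneousComponent, coeff_zero]
    split_ifs with ha
    · exact (mem_pow_idealOfVars_iff' _ _).1 hg a (by lia)
    · rfl
  rw [hg0, zero_sub] at hfg
  simpa using I.neg_mem hfg

lemma isArtinianRing_of_hilbertFunction {I : Ideal (MvPolynomial (Fin n) K)} {D : ℕ}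
    (hD : ∀ d, D ≤ d → hilbertFunction I d = 0) :
    IsArtinianRing (MvPolynomial (Fin n) K ⧸ I) := by
  have htop : (⨆ d ∈ Finset.range D, homogeneousSubmodule (Fin n) K d).map
      (Ideal.Quotient.mkₐ K I).toLinearMap = ⊤ := by
    rw [eq_top_iff]
    rintro x -
    obtain ⟨f, rfl⟩ := Ideal.Quotient.mk_surjective x
    rw [← sum_homogeneousComponent f, map_sum]
    refine Submodule.sum_mem _ fun d _ => ?_
    by_cases hd : d < D
    · exact ⟨_, Submodule.mem_iSup_of_mem d (Submodule.mem_iSup_of_mem (Finset.mem_range.2 hd)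
        (homogeneousComponent_isHomogeneous d f)), rfl⟩
    · rw [Ideal.Quotient.eq_zero_iff_mem.2 (hilbertFunction_eq_zero_iff.1 (hD d (not_lt.1 hd)) _
        (homogeneousComponent_isHomogeneous d f))]
      exact Submodule.zero_mem _
  have hfin : FiniteDimensional K (MvPolynomial (Fin n) K ⧸ I) := by
    refine Module.finite_def.2 ?_
    rw [← htop]
    exact (Submodule.fg_biSup _ _ fun d _ => homogeneousSubmodule_fg (Fin n) K d).map _
  exact IsArtinianRing.of_finite K _

end Quotient

/-! ### The lex ideal with a given Hilbert function -/

section LexIdeal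

variable {K : Type*} [Field K] {n : ℕ}

/-- The exponents of the monomials that span the lex ideal associated with `I`. -/
def lexExponents (I : Ideal (MvPolynomial (Fin n) K)) : Set (Fin n →₀ ℕ) :=
  {a | a ∈ restrictExp n (lexSeg n a.degree (Module.finrank K (idealPiece I a.degree)))}

/-- The lex ideal with the same Hilbert function as `I`. -/
def lexIdeal (I : Ideal (MvPolynomial (Fin n) K)) : Ideal (MvPolynomial (Fin n) K) :=
  Ideal.span ((fun a => monomial a (1 : K)) '' lexExponents I)

lemma finrank_mul_idealPiece_le (I : Ideal (MvPolynomial (Fin n) K)) (d : ℕ) :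
    Module.finrank K (homogeneousSubmodule (Fin n) K 1 * idealPiece I d :
      Submodule K (MvPolynomial (Fin n) K)) ≤ Module.finrank K (idealPiece I (d + 1)) := by
  have := finiteDimensional_of_le_homogeneous (idealPiece_le I (d + 1))
  refine Submodule.finrank_mono (le_inf (homogeneousSubmodule_one_mul_le (idealPiece_le I d)) ?_)
  exact Submodule.mul_le.2 fun f _ g hg => I.mul_mem_left f hg.2

variable [Infinite K]

/-- Since dim I_{d+1} ≥ dim R_1 I_d, Macaulay's theorem makes the shadow of the segment in degree d
fit into the segment in degree d + 1. -/
lemma add_single_mem_lexExponents {I : Ideal (MvPolynomial (Fin n) K)} {a : Fin n →₀ ℕ}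
    (ha : a ∈ lexExponents I) (i : Fin n) : a + Finsupp.single i 1 ∈ lexExponents I := by
  have h := shadowOf_lexSeg_subset ((lexGrowth_le_finrank_mul n a.degree
    (idealPiece_le I a.degree)).trans (finrank_mul_idealPiece_le I a.degree))
    (finrank_le_card_monomialsOf (idealPiece_le I (a.degree + 1)))
    (mem_shadowOf.2 ⟨_, ha, i, i.2, (extendExp_add_single a i).symm⟩)
  rwa [lexExponents, Set.mem_ofPred_eq, map_add, Finsupp.degree_single]

lemma isUpperSet_lexExponents (I : Ideal (MvPolynomial (Fin n) K)) :
    IsUpperSet (lexExponents I) := by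
  have key : ∀ c a : Fin n →₀ ℕ, a ∈ lexExponents I → a + c ∈ lexExponents I := by
    intro c
    induction c using Finsupp.induction_linear with
    | zero => intro a ha; rwa [add_zero]
    | add c e hc he => intro a ha; rw [← add_assoc]; exact he _ (hc _ ha)
    | single i k =>
      induction k with
      | zero => intro a ha; rwa [Finsupp.single_zero, add_zero]
      | succ k ih =>
        intro a ha
        rw [Finsupp.single_add, ← add_assoc]
        exact add_single_mem_lexExponents (ih a ha) i
  intro a b hab ha
  rw [← add_tsub_cancel_of_le hab]
  exact key _ a ha

lemma mem_lexIdeal {I : Ideal (MvPolynomial (Fin n) K)} {f : MvPolynomial (Fin n) K} :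
    f ∈ lexIdeal I ↔ ∀ a ∈ f.support, a ∈ lexExponents I := by
  rw [lexIdeal, mem_ideal_span_monomial_image]
  exact forall₂_congr fun a _ =>
    ⟨fun ⟨b, hb, hba⟩ => isUpperSet_lexExponents I hba hb, fun ha => ⟨a, ha, le_rfl⟩⟩

lemma idealPiece_lexIdeal (I : Ideal (MvPolynomial (Fin n) K)) (d : ℕ) :
    idealPiece (lexIdeal I) d = lexSpace K n d (Module.finrank K (idealPiece I d)) := by
  ext f
  rw [lexSpace_eq, mem_restrictSupport_iff, mem_idealPiece, mem_lexIdeal,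
    ← mem_homogeneousSubmodule, homogeneousSubmodule_eq_restrictSupport, mem_restrictSupport_iff,
    restrictExp_monomialsOf]
  constructor
  · rintro ⟨h1, h2⟩ a ha
    have hd : a.degree = d := h1 ha
    exact hd ▸ h2 a ha
  · intro h
    have hd : ∀ a ∈ f.support, a.degree = d := fun a ha =>
      extendExp_mem_monomialsOf.1 (topPart_subset _ (h ha))
    exact ⟨hd, fun a ha => by rw [lexExponents, Set.mem_ofPred_eq, hd a ha]; exact h ha⟩

lemma finrank_idealPiece_lexIdeal (I : Ideal (MvPolynomial (Fin n) K)) (d : ℕ) :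
    Module.finrank K (idealPiece (lexIdeal I) d) = Module.finrank K (idealPiece I d) := by
  rw [idealPiece_lexIdeal, lexSpace_eq, finrank_restrictSupport,
    ncard_restrictExp (isLexSeg_lexSeg _ _ _).1,
    card_lexSeg (finrank_le_card_monomialsOf (idealPiece_le I d))]

lemma hilbertFunction_lexIdeal (I : Ideal (MvPolynomial (Fin n) K)) :
    hilbertFunction (lexIdeal I) = hilbertFunction I := by
  ext d
  have h1 := hilbertFunction_add_finrank_idealPiece I d
  have h2 := hilbertFunction_add_finrank_idealPiece (lexIdeal I) d
  rw [finrank_idealPiece_lexIdeal] at h2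
  omega

lemma isGotzmann_lexIdeal (I : Ideal (MvPolynomial (Fin n) K)) : IsGotzmann (lexIdeal I) := by
  intro d
  rw [finrank_idealPiece_lexIdeal, idealPiece_lexIdeal]

lemma definesArtinianAlgebra_lexIdeal {I : Ideal (MvPolynomial (Fin n) K)}
    (hI : DefinesArtinianAlgebra I) : DefinesArtinianAlgebra (lexIdeal I) := by
  refine ⟨?_, ?_, ?_⟩
  · refine Ideal.homogeneous_span _ _ ?_
    rintro _ ⟨a, -, rfl⟩
    exact ⟨a.degree, isHomogeneous_monomial 1 rfl⟩
  · rw [Ne, ← hilbertFunction_zero_eq_zero_iff, hilbertFunction_lexIdeal,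
      hilbertFunction_zero_eq_zero_iff]
    exact hI.2.1
  · obtain ⟨D, hD⟩ := exists_forall_le_hilbertFunction_eq_zero hI
    exact isArtinianRing_of_hilbertFunction (D := D) fun d hd => by
      rw [hilbertFunction_lexIdeal]; exact hD d hd

end LexIdeal

/-! ### The weak Lefschetz property -/

section WLP

variable {K : Type*} [Field K] {n : ℕ}

lemma hasWLP_iff {I : Ideal (MvPolynomial (Fin n) K)} :
    HasWLP I ↔ ∀ᶠ c in genericFilter K n, HasMaximalRank I (linearForm c) := Iff.rfl

lemma hasMaximalRank_iff {I : Ideal (MvPolynomial (Fin n) K)} {c : Fin n → K} :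
    HasMaximalRank I (linearForm c) ↔
      ∀ d, min (hilbertFunction I d) (hilbertFunction I (d + 1)) ≤
        Module.finrank K ((quotientPiece I d).map
          (LinearMap.mulLeft K (Ideal.Quotient.mk I (linearForm c)))) :=
  forall_congr' fun d => ⟨fun h => h.ge, fun h => le_antisymm (finrank_map_mulLeft_le I c d) h⟩

lemma hasWLP_of_no_variables (I : Ideal (MvPolynomial (Fin 0) K)) : HasWLP I := by
  refine hasWLP_iff.2 (Filter.Eventually.of_forall fun c => hasMaximalRank_iff.2 fun d => ?_)
  have h := hilbertFunction_add_finrank_idealPiece I (d + 1)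
  rw [monomialsOf_zero_succ, Finset.card_empty] at h
  rw [show hilbertFunction I (d + 1) = 0 by omega, Nat.min_zero]
  exact Nat.zero_le _

/-- If a Gotzmann algebra has the weak Lefschetz property, then so does every artinian algebra with
the same Hilbert function. -/
theorem hasWLP_of_isGotzmann [Infinite K] {I J : Ideal (MvPolynomial (Fin n) K)}
    (hI : IsGotzmann I) (hIW : HasWLP I) (hJ : DefinesArtinianAlgebra J)
    (hIJ : hilbertFunction I = hilbertFunction J) : HasWLP J := by
  rcases n with _ | n
  · exact hasWLP_of_no_variables J
  have hdim : ∀ d, Module.finrank K (idealPiece I d) = Module.finrank K (idealPiece J d) := by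
    intro d
    have h1 := hilbertFunction_add_finrank_idealPiece I d
    have h2 := hilbertFunction_add_finrank_idealPiece J d
    rw [hIJ] at h1
    omega
  -- Maximal rank and equality in Green's theorem for I give an inequality that involves only the
  -- Hilbert function, and so it passes to J.
  have hbound : ∀ d, min (hilbertFunction J d) (hilbertFunction J (d + 1)) +
      numWithLast n (d + 1) (Module.finrank K (idealPiece J (d + 1))) ≤
        (monomialsOf (n + 1) d).card := by
    intro d
    have hgrowth := hI (d + 1)
    rw [finrank_homogeneousSubmodule_one_mul_lexSpace] at hgrowth
    obtain ⟨c, hc, hmax, hcol⟩ := ((eventually_generic_last_ne_zero K n).and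
      ((hasWLP_iff.1 hIW).and (eventually_numWithLast_le_finrank_colonBy n (d + 1)
        (idealPiece_le I (d + 1)) hgrowth))).exists
    have h1 := hasMaximalRank_iff.1 hmax d
    have h2 := finrank_map_mulLeft_add I (linearForm_ne_zero hc) d
    rw [hdim] at hcol
    rw [hIJ] at h1
    omega
  -- Only finitely many degrees matter, so the generic conditions can be imposed simultaneously.
  obtain ⟨D, hD⟩ := exists_forall_le_hilbertFunction_eq_zero hJ
  have hgreen : ∀ᶠ c in genericFilter K (n + 1), ∀ d ∈ Finset.range D,
      Module.finrank K (colonBy (idealPiece J (d + 1)) (linearForm c)) ≤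
        numWithLast n (d + 1) (Module.finrank K (idealPiece J (d + 1))) :=
    (Finset.eventually_all _).2 fun d _ =>
      eventually_finrank_colonBy_le_numWithLast n (d + 1) (idealPiece_le J (d + 1))
  refine hasWLP_iff.2 ?_
  filter_upwards [eventually_generic_last_ne_zero K n, hgreen] with c hc hcol
  refine hasMaximalRank_iff.2 fun d => ?_
  by_cases hd : d < D
  · have h1 := finrank_map_mulLeft_add J (linearForm_ne_zero hc) d
    have h2 := hcol d (Finset.mem_range.2 hd)
    have h3 := hbound d
    omega
  · rw [hD d (not_lt.1 hd), Nat.zero_min]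
    exact Nat.zero_le _

end WLP

end

/-! ### The two equivalences. -/

theorem corollary6 (K : Type*) [Field K] [CharZero K] (n : ℕ) (H : ℕ → ℕ)
    (hH : IsFiniteHilbertFunction K n H) :
    ((∀ I : Ideal (MvPolynomial (Fin n) K),
        DefinesArtinianAlgebra I → hilbertFunction I = H → HasWLP I) ↔
      (∀ I : Ideal (MvPolynomial (Fin n) K),
        DefinesArtinianAlgebra I → hilbertFunction I = H → IsGotzmann I → HasWLP I)) ∧
    ((∀ I : Ideal (MvPolynomial (Fin n) K),
        DefinesArtinianAlgebra I → hilbertFunction I = H → HasWLP I) ↔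
      (∃ I : Ideal (MvPolynomial (Fin n) K),
        DefinesArtinianAlgebra I ∧ hilbertFunction I = H ∧ IsGotzmann I ∧ HasWLP I)) := by
  -- Characteristic zero enters only through this: over an infinite field a generic condition is
  -- satisfied by some linear form.
  have : Infinite K := CharZero.infinite K
  obtain ⟨I₀, hI₀, hH₀⟩ := hH
  have hL := definesArtinianAlgebra_lexIdeal hI₀
  have hLH : hilbertFunction (lexIdeal I₀) = H := (hilbertFunction_lexIdeal I₀).trans hH₀
  have hLG := isGotzmann_lexIdeal I₀
  refine ⟨⟨fun h I hI hIH _ => h I hI hIH, fun h J hJ hJH => ?_⟩,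
    fun h => ⟨lexIdeal I₀, hL, hLH, hLG, h _ hL hLH⟩, ?_⟩
  · exact hasWLP_of_isGotzmann hLG (h _ hL hLH hLG) hJ (hLH.trans hJH.symm)
  · rintro ⟨I, _, hIH, hIG, hIW⟩ J hJ hJH
    exact hasWLP_of_isGotzmann hIG hIW hJ (hIH.trans hJH.symm)
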